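/- A production system has deterioration levels $\mathscr X=\{0,1,\ldots,\xi\}$, $\xi\in\mathbb N$, and is failed at level $\xi$. Production rates are chosen in $\mathscr S=[0,\bar s]$, $0<\bar s<\infty$; the base rate is $\lambda\ge 0$. The deterioration function $f:\mathscr S\to[0,\infty)$ and the revenue function $r:\mathscr S\to\mathbb R$ are continuous and weakly increasing with $f(0)=0$ and $r(0)\le 0$; the maintenance cost $c_m:\mathscr X\to[0,\infty)$ is weakly increasing and convex. An admissible policy from level $x\in\mathscr X$ is a filtered probability space carrying an adapted counting process $X=(X_k)_{k\ge 0}$ (non-decreasing, right-continuous, with jumps of size one) with $X_0=x$, where $k$ is the elapsed time, and a predictable $\mathscr S$-valued production rate $s=(s_k)_{k\ge0}$, such that $X$ has stochastic intensity $\lambda f(s_k)$, that is, $X_k-\int_0^k\lambda f(s_j)\,dj$ is a martingale, and such that almost surely $X_k\le\xi$ for all $k$ and the system is turned off after failure ($s_k=0$ whenever $X_j=\xi$ for some $j<k$). A failed system neither earns nor loses revenue. For time $t\ge 0$ until the planned maintenance moment let $$J^*_\lambda(x,t)=\sup\ \mathbb E\Big[\int_0^t r(s_k)\,\mathbf 1\{X_k<\xi\}\,dk-c_m(X_t)\Big],$$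 the supremum being over all admissible policies from level $x$ (when $r(0)=0$ the indicator can be omitted), and let $\Delta_\lambda(x,t)=J^*_\lambda(x,t)-J^*_\lambda(x+1,t)$. Then the supremum is over a non-empty set that is bounded above, and $J^*_\lambda$ is the solution of the Hamilton-Jacobi-Bellman system: for all $t\ge0$ (with a one-sided derivative at $t=0$) $$\frac{\partial J^*_\lambda(x,t)}{\partial t}=\begin{cases}\max_{s\in\mathscr S}\big[r(s)-\lambda f(s)\Delta_\lambda(x,t)\big], & x\in\{0,\ldots,\xi-1\},\\ 0, & x=\xi,\end{cases}$$ where the maximum is attained, and $J^*_\lambda(x,0)=-c_m(x)$ for all $x\in\mathscr X$. Moreover it is the only solution: for every $T>0$, any function on $\mathscr X\times[0,T]$ that satisfies this system on $[0,T]$ (with one-sided derivatives at the endpoints) and the boundary condition coincides with $J^*_\lambda$ there. -/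

import Mathlib

open MeasureTheory Set
open scoped NNReal

noncomputable section

/-- The data of the model together with its standing assumptions. Production rates range over
`[0, maxRate]` and deterioration levels over `{0, …, ξ}`; `f`, `r` and `c` matter only there. -/
structure ProductionModel where
  /-- failure level -/
  ξ : ℕ
  /-- maximum production rate -/
  maxRate : ℝ
  /-- base rate `λ` -/
  lam : ℝ
  /-- deterioration function -/
  f : ℝ → ℝ
  /-- revenue function -/
  r : ℝ → ℝ
  /-- maintenance cost function `c_m` -/
  c : ℕ → ℝ
  maxRate_pos : 0 < maxRate
  lam_nonneg : 0 ≤ lam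
  f_continuousOn : ContinuousOn f (Icc 0 maxRate)
  f_monotoneOn : MonotoneOn f (Icc 0 maxRate)
  f_zero : f 0 = 0
  r_continuousOn : ContinuousOn r (Icc 0 maxRate)
  r_monotoneOn : MonotoneOn r (Icc 0 maxRate)
  r_zero_nonpos : r 0 ≤ 0
  c_nonneg : ∀ x ≤ ξ, 0 ≤ c x
  c_monotoneOn : MonotoneOn c (Iic ξ)
  c_convex : ∀ x, x + 2 ≤ ξ → c (x + 1) - c x ≤ c (x + 2) - c (x + 1)

namespace ProductionModel

variable (M : ProductionModel)

/-- The set `𝒮` of production rates. -/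
def rates : Set ℝ := Icc 0 M.maxRate

/-- `(ℱ, X, s)` is a controlled deterioration process started at level `x`, on the probability
space `(Ω, P)`. Here `X k` is the deterioration level and `s k` the production rate after `k` time
units. The control is non-anticipating (predictable with respect to the history `ℱ`, to which `X`
is adapted), and `X` is a counting process with stochastic intensity `λ f(s_k)`. -/
structure IsAdmissible (x : ℕ) {Ω : Type} [mΩ : MeasurableSpace Ω] (P : Measure Ω)
    (ℱ : Filtration ℝ≥0 mΩ) (X : ℝ≥0 → Ω → ℕ) (s : ℝ≥0 → Ω → ℝ) : Prop where
  /-- the rate is chosen in `𝒮` -/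
  rate_mem : ∀ k ω, s k ω ∈ M.rates
  /-- the rate at time `k` is chosen on the basis of the history strictly before `k` -/
  predictable : IsStronglyPredictable ℱ s
  /-- the level is observed -/
  adapted : Adapted ℱ X
  start : ∀ ω, X 0 ω = x
  monotone : ∀ ω, Monotone fun k => X k ω
  right_continuous : ∀ ω k, ContinuousWithinAt (fun j => X j ω) (Ici k) k
  /-- every jump has size one: `X_k ≤ X_{k-} + 1` -/
  unit_jumps : ∀ ω k, 0 < k → ∃ j < k, X k ω ≤ X j ω + 1
  /-- the intensity is `λ f(s)`: the compensated counting process is a martingale -/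
  intensity : Martingale
    (fun (k : ℝ≥0) ω => (X k ω : ℝ) - ∫ j in (0 : ℝ)..(k : ℝ), M.lam * M.f (s j.toNNReal ω)) ℱ P
  /-- the deterioration never exceeds the failure level -/
  level_le : ∀ᵐ ω ∂P, ∀ k, X k ω ≤ M.ξ
  /-- once failed, the system is turned off -/
  off_after_failure : ∀ᵐ ω ∂P, ∀ j k, j < k → X j ω = M.ξ → s k ω = 0

/-- The revenue rate at deterioration level `x` and production rate `s`: `r(s)` while the system
functions; a failed system earns (and loses) nothing. -/
def revenueRate (x : ℕ) (s : ℝ) : ℝ := if x < M.ξ then M.r s else 0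

/-- Expected profit over `t` time units until the planned maintenance moment: revenue collected,
minus the maintenance cost of the terminal level. -/
def expectedProfit (t : ℝ) {Ω : Type} [MeasurableSpace Ω] (P : Measure Ω)
    (X : ℝ≥0 → Ω → ℕ) (s : ℝ≥0 → Ω → ℝ) : ℝ :=
  ∫ ω, ((∫ k in (0 : ℝ)..t, M.revenueRate (X k.toNNReal ω) (s k.toNNReal ω))
    - M.c (X t.toNNReal ω)) ∂P

/-- The expected profits that can be attained from level `x` with `t` time units to go. -/
def attainableProfits (x : ℕ) (t : ℝ) : Set ℝ :=
  {v | ∃ (Ω : Type) (mΩ : MeasurableSpace Ω) (P : Measure Ω) (_ : IsProbabilityMeasure P)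
    (ℱ : Filtration ℝ≥0 mΩ) (X : ℝ≥0 → Ω → ℕ) (s : ℝ≥0 → Ω → ℝ),
    M.IsAdmissible x P ℱ X s ∧ v = M.expectedProfit t P X s}

/-- The optimal expected profit `J*(x, t)`, where `t` is the time to go. -/
def optimalProfit (x : ℕ) (t : ℝ) : ℝ := sSup (M.attainableProfits x t)

/-- `J` solves the HJB system for times to go in `I`. The maximum over production rates is required
to be attained, and the time derivative is one-sided at an endpoint of `I`. -/
structure SolvesHJB (I : Set ℝ) (J : ℕ → ℝ → ℝ) : Prop where
  functioning : ∀ x < M.ξ, ∀ t ∈ I, ∃ d,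
    IsGreatest ((fun s => M.r s - M.lam * M.f s * (J x t - J (x + 1) t)) '' M.rates) d ∧
      HasDerivWithinAt (J x) d I t
  failed : ∀ t ∈ I, HasDerivWithinAt (J M.ξ) 0 I t
  boundary : ∀ x ≤ M.ξ, J x 0 = -M.c x

/-- If a system that is turned off earns and loses nothing (`r(0) = 0`), the revenue term of
`expectedProfit` is the integral of `r(s_k)` over the whole horizon. -/
theorem expectedProfit_eq_of_r_zero (h0 : M.r 0 = 0) {x : ℕ} {t : ℝ} {Ω : Type}
    [mΩ : MeasurableSpace Ω] {P : Measure Ω} {ℱ : Filtration ℝ≥0 mΩ} {X : ℝ≥0 → Ω → ℕ}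
    {s : ℝ≥0 → Ω → ℝ} (ht : 0 ≤ t) (h : M.IsAdmissible x P ℱ X s) :
    M.expectedProfit t P X s =
      ∫ ω, ((∫ k in (0 : ℝ)..t, M.r (s k.toNNReal ω)) - M.c (X t.toNNReal ω)) ∂P := by
  unfold expectedProfit
  refine integral_congr_ae ?_
  filter_upwards [h.level_le, h.off_after_failure] with ω hle hoff
  congr 1
  refine intervalIntegral.integral_congr_ae ?_
  have hsub : {k : ℝ | 0 < k ∧ X k.toNNReal ω = M.ξ ∧ s k.toNNReal ω ≠ 0}.Subsingleton := by
    rintro a ⟨ha, hXa, hsa⟩ b ⟨hb, hXb, hsb⟩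
    rcases lt_trichotomy a b with hab | hab | hab
    · exact absurd (hoff _ _ ((Real.toNNReal_lt_toNNReal_iff hb).2 hab) hXa) hsb
    · exact hab
    · exact absurd (hoff _ _ ((Real.toNNReal_lt_toNNReal_iff ha).2 hab) hXb) hsa
  have hae : ∀ᵐ k : ℝ, ¬ (0 < k ∧ X k.toNNReal ω = M.ξ ∧ s k.toNNReal ω ≠ 0) :=
    measure_eq_zero_iff_ae_notMem.1 (hsub.measure_zero volume)
  filter_upwards [hae] with k hk hkt
  rw [uIoc_of_le ht] at hkt
  unfold revenueRate
  split_ifs with hlt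
  · rfl
  · have hX : X k.toNNReal ω = M.ξ := le_antisymm (hle _) (not_lt.1 hlt)
    have hs : s k.toNNReal ω = 0 := by
      by_contra hne
      exact hk ⟨hkt.1, hX, hne⟩
    rw [hs, h0]

end ProductionModel

end

open MeasureTheory Set
open scoped NNReal

noncomputable section

namespace ProductionModel

variable (M : ProductionModel)

/-! ### The Hamiltonian of the control problem -/

section Hamiltonian

/-! Write `H p` for the maximum over `s` of `r s - λ f s * p`. The HJB system is triangular: the
equation of level `x` involves only the levels `x` and `x + 1`, and the failure level is constant in
time. Since `H` is Lipschitz, scalar equations can be solved from the top level downwards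
(`exists_solvesHJB`).

The rest is verification. Let `J` be any solution on `[0, t]`. Dynkin's formula
(`integral_increment_sub_drift_eq_zero`), applied to `J` along a controlled path, shows that the
expected profit of a policy is `J x t` plus the expected accumulated gap `r s - λ f s * Δ - H Δ`
(`integrable_gap_and_expectedProfit_eq`). The gap is never positive, so `J x t` bounds all
attainable profits.

Conversely, policies with arbitrarily small loss exist. On each interval of a grid of width `h`, fix
a maximiser for the level and time at the start of the interval, use it until the next jump or the
end of the interval, then idle until the interval ends. One such interval is realised by adjoining
an independent exponential clock to the probability space (`IsAdmissible.extend`). A stale rate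
costs `O(h)` per unit of time, and idling affects at most `ξ` intervals, one per jump. No measurable
feedback control is needed.

Thus every solution equals the supremum, which gives uniqueness, and the existence of a solution
makes the supremum itself a solution. -/

lemma zero_mem_rates : (0 : ℝ) ∈ M.rates := ⟨le_rfl, M.maxRate_pos.le⟩

lemma maxRate_mem_rates : M.maxRate ∈ M.rates := ⟨M.maxRate_pos.le, le_rfl⟩

lemma f_nonneg {s : ℝ} (hs : s ∈ M.rates) : 0 ≤ M.f s :=
  M.f_zero ▸ M.f_monotoneOn M.zero_mem_rates hs hs.1

lemma f_le {s : ℝ} (hs : s ∈ M.rates) : M.f s ≤ M.f M.maxRate :=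
  M.f_monotoneOn hs M.maxRate_mem_rates hs.2

/-- The largest intensity that can be chosen. -/
def maxIntensity : ℝ≥0 :=
  ⟨M.lam * M.f M.maxRate, mul_nonneg M.lam_nonneg (M.f_nonneg M.maxRate_mem_rates)⟩

lemma intensity_nonneg {s : ℝ} (hs : s ∈ M.rates) : 0 ≤ M.lam * M.f s :=
  mul_nonneg M.lam_nonneg (M.f_nonneg hs)

lemma intensity_le {s : ℝ} (hs : s ∈ M.rates) : M.lam * M.f s ≤ M.maxIntensity :=
  mul_le_mul_of_nonneg_left (M.f_le hs) M.lam_nonneg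

/-- The maximal net revenue rate when a jump of the level costs `p`. -/
def hamiltonian (p : ℝ) : ℝ := sSup ((fun s => M.r s - M.lam * M.f s * p) '' M.rates)

lemma isGreatest_hamiltonian (p : ℝ) :
    IsGreatest ((fun s => M.r s - M.lam * M.f s * p) '' M.rates) (M.hamiltonian p) := by
  refine IsCompact.isGreatest_sSup ?_ (Set.Nonempty.image _ ⟨0, M.zero_mem_rates⟩)
  refine IsCompact.image_of_continuousOn isCompact_Icc ?_
  exact M.r_continuousOn.sub ((continuousOn_const.mul M.f_continuousOn).mul continuousOn_const)

lemma le_hamiltonian {s : ℝ} (hs : s ∈ M.rates) (p : ℝ) :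
    M.r s - M.lam * M.f s * p ≤ M.hamiltonian p :=
  (M.isGreatest_hamiltonian p).2 ⟨s, hs, rfl⟩

lemma exists_hamiltonian_eq (p : ℝ) :
    ∃ s ∈ M.rates, M.r s - M.lam * M.f s * p = M.hamiltonian p :=
  (M.isGreatest_hamiltonian p).1

lemma r_zero_le_hamiltonian (p : ℝ) : M.r 0 ≤ M.hamiltonian p := by
  have := M.le_hamiltonian M.zero_mem_rates p
  simpa [M.f_zero] using this

/-- Intensities are non-negative, so a dearer jump lowers every net revenue rate. Together with
`r_zero_le_hamiltonian` this bounds the Hamiltonian on any half-line bounded below. -/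
lemma antitone_hamiltonian : Antitone M.hamiltonian := by
  intro p q hpq
  obtain ⟨s, hs, h⟩ := M.exists_hamiltonian_eq q
  rw [← h]
  refine le_trans ?_ (M.le_hamiltonian hs p)
  have := mul_le_mul_of_nonneg_left hpq (M.intensity_nonneg hs)
  linarith

/-- The maximiser at `p` is also available at `q`, where its net revenue differs by its intensity
times the change of price. -/
lemma hamiltonian_le_add (p q : ℝ) :
    M.hamiltonian p ≤ M.hamiltonian q + M.maxIntensity * |p - q| := by
  obtain ⟨s, hs, h⟩ := M.exists_hamiltonian_eq p
  have h1 := M.le_hamiltonian hs q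
  have h2 : M.lam * M.f s * (q - p) ≤ M.maxIntensity * |p - q| :=
    (mul_le_mul_of_nonneg_left (by rw [abs_sub_comm]; exact le_abs_self _)
      (M.intensity_nonneg hs)).trans
      (mul_le_mul_of_nonneg_right (M.intensity_le hs) (abs_nonneg _))
  linarith

lemma lipschitzWith_hamiltonian : LipschitzWith M.maxIntensity M.hamiltonian := by
  refine LipschitzWith.of_dist_le_mul fun p q => ?_
  rw [Real.dist_eq, Real.dist_eq, abs_sub_le_iff]
  have h1 := M.hamiltonian_le_add p q
  have h2 := M.hamiltonian_le_add q p
  rw [abs_sub_comm q p] at h2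
  constructor <;> linarith

end Hamiltonian

/-! ### Existence of a solution -/

section Existence

/-- The scalar equation `y' = H(y - g)` has a solution on every horizon. -/
lemma exists_hasDerivWithinAt_hamiltonian {T : ℝ} (hT : 0 ≤ T) {g : ℝ → ℝ}
    (hg : ContinuousOn g (Icc 0 T)) (y₀ : ℝ) :
    ∃ y : ℝ → ℝ, y 0 = y₀ ∧
      ∀ t ∈ Icc 0 T, HasDerivWithinAt y (M.hamiltonian (y t - g t)) (Icc 0 T) t := by
  obtain ⟨G, hG⟩ := isCompact_Icc.bddAbove_image hg
  replace hG : ∀ t ∈ Icc 0 T, g t ≤ G := fun t ht => hG ⟨t, ht, rfl⟩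
  -- An a priori lower bound: slopes are at least `r 0 ≤ 0`, so a solution stays above `m` on `[0,
  -- T]`. Cutting `y` off at `m` makes the field bounded, by monotonicity of the Hamiltonian, and
  -- the cut-off turns out to be inactive.
  set m : ℝ := y₀ + M.r 0 * T with hm
  set F : ℝ → ℝ → ℝ := fun t y => M.hamiltonian (max y m - g t) with hF
  set L : ℝ≥0 := ⟨max |M.r 0| |M.hamiltonian (m - G)|, (abs_nonneg _).trans (le_max_left _ _)⟩
  have hlow : ∀ t y, M.r 0 ≤ F t y := fun t y => M.r_zero_le_hamiltonian _
  -- A field bounded by `L` moves the solution by at most `L * T`; with this radius a single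
  -- application covers the whole horizon.
  have hpl : IsPicardLindelof F (⟨0, le_rfl, hT⟩ : Icc 0 T) y₀ (L * ⟨T, hT⟩) 0 L
      M.maxIntensity := by
    refine ⟨fun t _ => ?_, fun y _ => ?_, fun t ht y _ => ?_, ?_⟩
    · refine LipschitzWith.lipschitzOnWith ?_
      have h1 : LipschitzWith 1 fun y : ℝ => max y m - g t := by
        refine LipschitzWith.of_dist_le_mul fun a b => ?_
        rw [Real.dist_eq, Real.dist_eq, NNReal.coe_one, one_mul, sub_sub_sub_cancel_right]
        exact abs_max_sub_max_le_abs a b m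
      have h2 := M.lipschitzWith_hamiltonian.comp h1
      rwa [mul_one] at h2
    · exact M.lipschitzWith_hamiltonian.continuous.comp_continuousOn (continuousOn_const.sub hg)
    · rw [Real.norm_eq_abs]
      refine (abs_le_max_abs_abs (hlow t y) (M.antitone_hamiltonian ?_) :)
      exact sub_le_sub (le_max_right _ _) (hG t ht)
    · change (L : ℝ) * max (T - 0) (0 - 0) ≤ (L * T : ℝ) - 0
      rw [sub_zero, sub_zero, sub_zero, max_eq_left hT]
  obtain ⟨y, hy0, hy⟩ := hpl.exists_eq_forall_mem_Icc_hasDerivWithinAt₀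
  refine ⟨y, hy0, fun t ht => ?_⟩
  have hcont : ContinuousOn y (Icc 0 T) := fun t ht => (hy t ht).continuousWithinAt
  have hder : ∀ t ∈ interior (Icc 0 T), HasDerivAt y (F t (y t)) t := by
    intro t ht
    rw [interior_Icc] at ht
    exact (hy t (Ioo_subset_Icc_self ht)).hasDerivAt (Icc_mem_nhds ht.1 ht.2)
  have hge : M.r 0 * t ≤ y t - y₀ := by
    have := (convex_Icc 0 T).mul_sub_le_image_sub_of_le_deriv hcont
      (fun t ht => (hder t ht).differentiableAt.differentiableWithinAt)
      (fun t ht => by rw [(hder t ht).deriv]; exact hlow t _)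
      0 ⟨le_rfl, hT⟩ t ht ht.1
    rw [sub_zero] at this
    rw [← hy0]
    exact this
  have hmy : m ≤ y t := by
    have := mul_le_mul_of_nonpos_left ht.2 M.r_zero_nonpos
    linarith
  have := hy t ht
  simpa only [hF, max_eq_left hmy] using this

lemma exists_solvesHJB {T : ℝ} (hT : 0 ≤ T) : ∃ J : ℕ → ℝ → ℝ, M.SolvesHJB (Icc 0 T) J := by
  -- Downward induction: `n` counts the functioning levels, nearest to failure, whose equations are
  -- already solved.
  have key : ∀ n ≤ M.ξ, ∃ J : ℕ → ℝ → ℝ,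
      (∀ x < M.ξ, M.ξ ≤ x + n → J x 0 = -M.c x ∧ ∀ t ∈ Icc 0 T,
        HasDerivWithinAt (J x) (M.hamiltonian (J x t - J (x + 1) t)) (Icc 0 T) t) ∧
      J M.ξ = fun _ => -M.c M.ξ := by
    intro n
    induction n with
    | zero =>
      intro _
      exact ⟨fun _ _ => -M.c M.ξ, fun x hx h => absurd h (by omega), rfl⟩
    | succ n ih =>
      intro hn
      obtain ⟨J, hJ, hJξ⟩ := ih (by omega)
      obtain ⟨z, hz⟩ : ∃ z, z + (n + 1) = M.ξ := ⟨M.ξ - (n + 1), by omega⟩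
      have hcont : ContinuousOn (J (z + 1)) (Icc 0 T) := by
        rcases Nat.eq_or_lt_of_le (show z + 1 ≤ M.ξ by omega) with h | h
        · rw [h, hJξ]; exact continuousOn_const
        · exact fun t ht => ((hJ (z + 1) h (by omega)).2 t ht).continuousWithinAt
      obtain ⟨y, hy0, hy⟩ := M.exists_hasDerivWithinAt_hamiltonian hT hcont (-M.c z)
      -- Overwriting level `z` is harmless, because the equations of the levels above `z` do not
      -- refer to it.
      refine ⟨Function.update J z y, fun x hx hxn => ?_, ?_⟩
      · rw [Function.update_of_ne (show x + 1 ≠ z by omega)]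
        rcases eq_or_ne x z with rfl | hxz
        · rw [Function.update_self]
          exact ⟨hy0, hy⟩
        · rw [Function.update_of_ne hxz]
          exact hJ x hx (by omega)
      · rw [Function.update_of_ne (by omega), hJξ]
  obtain ⟨J, hJ, hJξ⟩ := key M.ξ le_rfl
  refine ⟨J, fun x hx t ht => ⟨_, M.isGreatest_hamiltonian _, (hJ x hx (by omega)).2 t ht⟩,
    fun t _ => ?_, fun x hx => ?_⟩
  · rw [hJξ]; exact hasDerivWithinAt_const _ _ _
  · rcases Nat.eq_or_lt_of_le hx with rfl | h
    · rw [hJξ]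
    · exact (hJ x h (by omega)).1

end Existence

/-! ### Elementary properties of solutions -/

namespace SolvesHJB

variable {M} {I I' : Set ℝ} {J : ℕ → ℝ → ℝ}

lemma hasDerivWithinAt (h : M.SolvesHJB I J) {x : ℕ} (hx : x < M.ξ) {t : ℝ} (ht : t ∈ I) :
    HasDerivWithinAt (J x) (M.hamiltonian (J x t - J (x + 1) t)) I t := by
  obtain ⟨d, hd, hd'⟩ := h.functioning x hx t ht
  rwa [hd.unique (M.isGreatest_hamiltonian _)] at hd'

lemma continuousOn (h : M.SolvesHJB I J) {x : ℕ} (hx : x ≤ M.ξ) : ContinuousOn (J x) I := by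
  intro t ht
  rcases Nat.eq_or_lt_of_le hx with rfl | hlt
  · exact (h.failed t ht).continuousWithinAt
  · exact (h.hasDerivWithinAt hlt ht).continuousWithinAt

lemma mono (h : M.SolvesHJB I J) (hI : I' ⊆ I) : M.SolvesHJB I' J where
  functioning x hx t ht := by
    obtain ⟨d, hd, hd'⟩ := h.functioning x hx t (hI ht)
    exact ⟨d, hd, hd'.mono hI⟩
  failed t ht := (h.failed t (hI ht)).mono hI
  boundary := h.boundary

end SolvesHJB

end ProductionModel

/-! ### Regularity of paths with unit jumps -/

section UnitJumps

/-- A right-continuous non-decreasing path with unit jumps makes at most one jump in each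
sufficiently short subinterval of a compact interval. -/
lemma exists_forall_le_add_one_of_unit_jumps {Y : ℝ≥0 → ℕ} (hmono : Monotone Y)
    (hright : ∀ k, ContinuousWithinAt Y (Ici k) k)
    (hjump : ∀ k, 0 < k → ∃ j < k, Y k ≤ Y j + 1) (t : ℝ≥0) :
    ∃ δ > 0, ∀ a ≤ t, ∀ b, a ≤ b → dist b a < δ → Y b ≤ Y a + 1 := by
  -- Near `k` the path is at most `Y k` up to some `u > k`, by right continuity, and at least `Y k -
  -- 1` after some `j < k`, by the unit jump. A Lebesgue number of the cover by these neighbourhoods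
  -- is the required `δ`.
  have hloc : ∀ k : ℝ≥0, ∃ c : Set ℝ≥0, IsOpen c ∧ k ∈ c ∧
      ∀ a ∈ c, ∀ b ∈ c, Y b ≤ Y a + 1 := by
    intro k
    have h1 : {j | Y j = Y k} ∈ nhdsWithin k (Ici k) := by
      have := (hright k) (IsOpen.mem_nhds (isOpen_discrete {Y k}) rfl)
      exact this
    obtain ⟨u, hu, hsub⟩ := (mem_nhdsGE_iff_exists_Ico_subset' (show k < k + 1 by simp)).1 h1
    have hlt : ∀ b < u, Y b ≤ Y k := by
      intro b hb
      rcases le_total b k with h | h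
      · exact hmono h
      · exact (hsub ⟨h, hb⟩).le
    rcases eq_or_lt_of_le (zero_le (a := k)) with rfl | hk
    · exact ⟨Iio u, isOpen_Iio, hu, fun a _ b hb =>
        (hlt b hb).trans ((hmono (zero_le (a := a))).trans (Nat.le_succ _))⟩
    · obtain ⟨j, hj, hjk⟩ := hjump k hk
      exact ⟨Ioo j u, isOpen_Ioo, ⟨hj, hu⟩, fun a ha b hb =>
        (hlt b hb.2).trans (hjk.trans (Nat.succ_le_succ (hmono ha.1.le)))⟩
  choose c hc hkc hcY using hloc
  obtain ⟨δ, hδ, h⟩ := lebesgue_number_lemma_of_metric (isCompact_Icc (a := (0 : ℝ≥0)) (b := t))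
    hc (fun k _ => mem_iUnion.2 ⟨k, hkc k⟩)
  refine ⟨δ, hδ, fun a ha b _ hd => ?_⟩
  obtain ⟨i, hi⟩ := h a ⟨zero_le, ha⟩
  exact hcY i a (hi (Metric.mem_ball_self hδ)) b (hi hd)

/-- A right-continuous non-decreasing process with values in `ℕ` is jointly measurable. -/
lemma measurable_uncurry_of_monotone_right_continuous {Ω : Type*} [MeasurableSpace Ω]
    {X : ℝ≥0 → Ω → ℕ} (hX : ∀ k, Measurable (X k)) (hmono : ∀ ω, Monotone fun k => X k ω)
    (hright : ∀ ω k, ContinuousWithinAt (fun j => X j ω) (Ici k) k) :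
    Measurable fun p : ℝ≥0 × Ω => X p.1 p.2 := by
  refine measurable_of_Iio fun y => ?_
  obtain ⟨D, hD, hDd⟩ := TopologicalSpace.exists_countable_dense ℝ≥0
  -- A path below `y` at `k` stays there for a while, hence up to some later time in the countable
  -- dense set; the converse is monotonicity.
  have : (fun p : ℝ≥0 × Ω => X p.1 p.2) ⁻¹' Iio y =
      ⋃ q ∈ D, Iio q ×ˢ (X q ⁻¹' Iio y) := by
    ext ⟨k, ω⟩
    simp only [mem_preimage, mem_Iio, mem_iUnion, mem_prod, exists_prop]
    constructor
    · intro h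
      have h1 : {j | X j ω = X k ω} ∈ nhdsWithin k (Ici k) := by
        have := (hright ω k) (IsOpen.mem_nhds (isOpen_discrete {X k ω}) rfl)
        exact this
      obtain ⟨u, hu, hsub⟩ := (mem_nhdsGE_iff_exists_Ico_subset' (show k < k + 1 by simp)).1 h1
      obtain ⟨q, hq, hqu⟩ := hDd.exists_between hu
      exact ⟨q, hq, hqu.1, by rw [show X q ω = X k ω from hsub ⟨hqu.1.le, hqu.2⟩]; exact h⟩
    · rintro ⟨q, _, hkq, hq⟩
      exact (hmono ω hkq.le).trans_lt hq
  rw [this]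
  exact MeasurableSet.biUnion hD fun q _ =>
    measurableSet_Iio.prod (hX q measurableSet_Iio)

end UnitJumps

/-! ### First-order expansion along a path -/

section Dynkin

/-- The path integral of a bounded jointly measurable process is integrable. -/
lemma integrable_intervalIntegral_of_abs_le {Ω : Type*} [MeasurableSpace Ω] {P : Measure Ω}
    [IsFiniteMeasure P] {g : ℝ → Ω → ℝ} (hg : Measurable fun p : ℝ × Ω => g p.1 p.2) {C : ℝ}
    (hC : ∀ k ω, |g k ω| ≤ C) (a b : ℝ) : Integrable (fun ω => ∫ k in a..b, g k ω) P := by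
  have hm : ∀ s : Set ℝ, StronglyMeasurable fun ω => ∫ k in s, g k ω := fun s =>
    StronglyMeasurable.integral_prod_left (f := g) hg.stronglyMeasurable
  refine Integrable.of_bound (C := C * |b - a|) ?_ ?_
  · exact ((hm _).sub (hm _)).aestronglyMeasurable
  · exact Filter.Eventually.of_forall fun ω =>
      intervalIntegral.norm_integral_le_of_norm_le_const fun k _ => hC k ω

lemma intervalIntegrable_of_abs_le {g : ℝ → ℝ} (hg : Measurable g) {C : ℝ} (hC : ∀ k, |g k| ≤ C)
    (a b : ℝ) : IntervalIntegrable g volume a b := by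
  rw [intervalIntegrable_iff]
  have : IsFiniteMeasure (volume.restrict (uIoc a b)) := ⟨by simp [uIoc]⟩
  exact Integrable.of_bound (C := C) hg.aestronglyMeasurable
    (Filter.Eventually.of_forall hC)

/-- The drift of `v(X, ·)` when `X` has level `y` and intensity `q` at time `k`. -/
def drift (v v' : ℕ → ℝ → ℝ) (y : ℕ) (q k : ℝ) : ℝ := v' y k + q * (v (y + 1) k - v y k)

lemma abs_sub_le_two_mul {a b C : ℝ} (ha : |a| ≤ C) (hb : |b| ≤ C) : |a - b| ≤ 2 * C := by
  have := abs_sub a b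
  linarith

lemma abs_drift_le {v v' : ℕ → ℝ → ℝ} {C K q : ℝ} (hv : ∀ y k, |v y k| ≤ C)
    (hv' : ∀ y k, |v' y k| ≤ C) (hq : 0 ≤ q) (hqK : q ≤ K) (y : ℕ) (k : ℝ) :
    |drift v v' y q k| ≤ C + 2 * C * K := by
  have h1 := abs_sub_le_two_mul (hv (y + 1) k) (hv y k)
  have h2 : |q * (v (y + 1) k - v y k)| ≤ K * (2 * C) := by
    rw [abs_mul, abs_of_nonneg hq]
    exact mul_le_mul hqK h1 (abs_nonneg _) (hq.trans hqK)
  have := abs_add_le (v' y k) (q * (v (y + 1) k - v y k))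
  unfold drift
  linarith [hv' y k]

lemma measurable_uncurry_comp {α : Type*} [MeasurableSpace α] {v : ℕ → ℝ → ℝ}
    (hv : ∀ y, Measurable (v y)) {Y : α → ℕ} (hY : Measurable Y) {k : α → ℝ} (hk : Measurable k) :
    Measurable fun a => v (Y a) (k a) :=
  (measurable_from_prod_countable_right (f := fun p : ℕ × ℝ => v p.1 p.2) hv).comp (hY.prodMk hk)

lemma measurable_drift {α : Type*} [MeasurableSpace α] {v v' : ℕ → ℝ → ℝ}
    (hv : ∀ y, Measurable (v y)) (hv' : ∀ y, Measurable (v' y)) {Y : α → ℕ} (hY : Measurable Y)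
    {q k : α → ℝ} (hq : Measurable q) (hk : Measurable k) :
    Measurable fun a => drift v v' (Y a) (q a) (k a) :=
  (measurable_uncurry_comp hv' hY hk).add (hq.mul
    ((measurable_uncurry_comp hv ((measurable_of_countable (· + 1)).comp hY) hk).sub
      (measurable_uncurry_comp hv hY hk)))

/-- First-order expansion of `v(Y, ·)` along a path, with an error that is quadratic in the length
of the interval except where the path jumps. -/
lemma abs_increment_sub_drift_le {v v' : ℕ → ℝ → ℝ} {C K t : ℝ} {N : ℕ}
    (hv : ∀ y k, |v y k| ≤ C) (hv' : ∀ y k, |v' y k| ≤ C)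
    (hvm : ∀ y, Measurable (v y)) (hvm' : ∀ y, Measurable (v' y))
    (hftc : ∀ y a b, 0 ≤ a → a ≤ b → b ≤ t → v y b - v y a = ∫ k in a..b, v' y k)
    {Y : ℝ → ℕ} (hY : Monotone Y) (hN : ∀ k, Y k ≤ N) {q : ℝ → ℝ} (hqm : Measurable q)
    (hq : ∀ k, 0 ≤ q k) (hqK : ∀ k, q k ≤ K) {a b : ℝ} (ha : 0 ≤ a) (hab : a ≤ b) (hbt : b ≤ t) :
    |v (Y b) b - v (Y a) a - (∫ k in a..b, drift v v' (Y k) (q k) k)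
      - (v (Y a + 1) a - v (Y a) a) * (((Y b : ℝ) - Y a) - ∫ k in a..b, q k)|
      ≤ 2 * C * K * (b - a) ^ 2 + (2 * C + 4 * C * K) * (b - a) * ((Y b : ℝ) - Y a)
        + (2 * C + 2 * C * N) * (if Y a + 2 ≤ Y b then 1 else 0) := by
  have hC : 0 ≤ C := (abs_nonneg _).trans (hv 0 0)
  have hK : 0 ≤ K := (hq 0).trans (hqK 0)
  have hba : 0 ≤ b - a := sub_nonneg.2 hab
  have hle : Y a ≤ Y b := hY hab
  have hqi : |∫ k in a..b, q k| ≤ K * (b - a) := by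
    have := intervalIntegral.norm_integral_le_of_norm_le_const (a := a) (b := b) (f := q) (C := K)
      (fun k _ => by rw [Real.norm_eq_abs, abs_of_nonneg (hq k)]; exact hqK k)
    rwa [Real.norm_eq_abs, abs_of_nonneg hba] at this
  have hdi : |∫ k in a..b, drift v v' (Y k) (q k) k| ≤ (C + 2 * C * K) * (b - a) := by
    have := intervalIntegral.norm_integral_le_of_norm_le_const (a := a) (b := b)
      (f := fun k => drift v v' (Y k) (q k) k) (C := C + 2 * C * K)
      (fun k _ => abs_drift_le hv hv' (hq k) (hqK k) _ _)
    rwa [Real.norm_eq_abs, abs_of_nonneg hba] at this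
  have hinc : ∀ y, ∀ k ∈ Icc a b, |v y k - v y a| ≤ C * (b - a) := by
    intro y k hk
    rw [hftc y a k ha hk.1 (hk.2.trans hbt)]
    have := intervalIntegral.norm_integral_le_of_norm_le_const (a := a) (b := k)
      (f := v' y) (C := C) (fun k _ => hv' y k)
    rw [Real.norm_eq_abs, abs_of_nonneg (sub_nonneg.2 hk.1)] at this
    exact this.trans (mul_le_mul_of_nonneg_left (by linarith [hk.2]) hC)
  have hδ : |v (Y a + 1) a - v (Y a) a| ≤ 2 * C := abs_sub_le_two_mul (hv _ _) (hv _ _)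
  have hδq : |(v (Y a + 1) a - v (Y a) a) * ∫ k in a..b, q k| ≤ 2 * C * (K * (b - a)) := by
    rw [abs_mul]
    exact mul_le_mul hδ hqi (abs_nonneg _) (by positivity)
  have hsq : 0 ≤ 2 * C * K * (b - a) ^ 2 := by positivity
  -- Without a jump, the intensity term of the drift cancels against the compensator up to the
  -- variation of `v` over the interval. This leaves an integrand of order `b - a`, hence a
  -- quadratic error.
  rcases Nat.eq_or_lt_of_le hle with heq | hlt
  · have hconst : ∀ k ∈ Icc a b, Y k = Y a := fun k hk =>
      le_antisymm (heq ▸ hY hk.2) (hY hk.1)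
    rw [if_neg (by omega), ← heq, hftc _ a b ha hab hbt, sub_self, mul_zero, mul_zero, add_zero,
      add_zero]
    have hqI := intervalIntegrable_of_abs_le hqm (C := K)
      (fun k => by rw [abs_of_nonneg (hq k)]; exact hqK k) a b
    have hvI := intervalIntegrable_of_abs_le (hvm' (Y a)) (hv' (Y a)) a b
    have hdI : IntervalIntegrable (fun k => drift v v' (Y k) (q k) k) volume a b :=
      intervalIntegrable_of_abs_le
        (measurable_drift hvm hvm' hY.measurable hqm measurable_id)
        (fun k => abs_drift_le hv hv' (hq k) (hqK k) _ _) a b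
    have : (∫ k in a..b, v' (Y a) k) - (∫ k in a..b, drift v v' (Y k) (q k) k)
        - (v (Y a + 1) a - v (Y a) a) * (0 - ∫ k in a..b, q k)
        = ∫ k in a..b, (v' (Y a) k - drift v v' (Y k) (q k) k)
          + (v (Y a + 1) a - v (Y a) a) * q k := by
      rw [intervalIntegral.integral_add (hvI.sub hdI) (hqI.const_mul _),
        intervalIntegral.integral_sub hvI hdI, intervalIntegral.integral_const_mul]
      ring
    rw [this]
    have hb := intervalIntegral.norm_integral_le_of_norm_le_const (a := a) (b := b)
      (f := fun k => (v' (Y a) k - drift v v' (Y k) (q k) k)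
          + (v (Y a + 1) a - v (Y a) a) * q k) (C := 2 * C * K * (b - a)) (fun k hk => by
        rw [uIoc_of_le hab] at hk
        have hk' : k ∈ Icc a b := Ioc_subset_Icc_self hk
        rw [hconst k hk', Real.norm_eq_abs]
        have e : v' (Y a) k - drift v v' (Y a) (q k) k + (v (Y a + 1) a - v (Y a) a) * q k
          = q k * ((v (Y a) k - v (Y a) a) - (v (Y a + 1) k - v (Y a + 1) a)) := by
          unfold drift; ring
        rw [e, abs_mul, abs_of_nonneg (hq k)]
        have := mul_le_mul (hqK k)
          (abs_sub_le_two_mul (hinc (Y a) k hk') (hinc (Y a + 1) k hk')) (abs_nonneg _) hK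
        linarith)
    rw [Real.norm_eq_abs, abs_of_nonneg hba] at hb
    linarith
  -- With exactly one jump the jump of `v` itself cancels and the remainder is linear in `b - a`,
  -- charged to the factor `Y b - Y a`. Several jumps are bounded crudely and charged to the
  -- indicator.
  · rcases Nat.eq_or_lt_of_le (Nat.succ_le_of_lt hlt) with heq | hlt2
    · have hYb : Y b = Y a + 1 := heq.symm
      rw [if_neg (by omega), hYb]
      push_cast
      have e : v (Y a + 1) b - v (Y a) a - (∫ k in a..b, drift v v' (Y k) (q k) k)
          - (v (Y a + 1) a - v (Y a) a) * ((Y a : ℝ) + 1 - Y a - ∫ k in a..b, q k)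
          = (v (Y a + 1) b - v (Y a + 1) a) - (∫ k in a..b, drift v v' (Y k) (q k) k)
            + (v (Y a + 1) a - v (Y a) a) * ∫ k in a..b, q k := by ring
      rw [e]
      have h1 := hinc (Y a + 1) b ⟨hab, le_rfl⟩
      have h2 := abs_add_le ((v (Y a + 1) b - v (Y a + 1) a)
        - (∫ k in a..b, drift v v' (Y k) (q k) k)) ((v (Y a + 1) a - v (Y a) a) * ∫ k in a..b, q k)
      have h3 := abs_sub (v (Y a + 1) b - v (Y a + 1) a)
        (∫ k in a..b, drift v v' (Y k) (q k) k)
      linarith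
    · rw [if_pos (by omega)]
      have hY1 : (1 : ℝ) ≤ (Y b : ℝ) - Y a := by
        have : ((Y a + 1 : ℕ) : ℝ) ≤ Y b := by exact_mod_cast hlt
        push_cast at this; linarith
      have hYN : (Y b : ℝ) - Y a ≤ N := by
        have h1 : (Y b : ℝ) ≤ N := by exact_mod_cast hN b
        have h2 : (0 : ℝ) ≤ Y a := Nat.cast_nonneg _
        linarith
      have h1 : |v (Y b) b - v (Y a) a| ≤ 2 * C := abs_sub_le_two_mul (hv _ _) (hv _ _)
      have h2 := abs_sub (v (Y b) b - v (Y a) a) (∫ k in a..b, drift v v' (Y k) (q k) k)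
      have h3 := abs_sub (v (Y b) b - v (Y a) a - ∫ k in a..b, drift v v' (Y k) (q k) k)
        ((v (Y a + 1) a - v (Y a) a) * (((Y b : ℝ) - Y a) - ∫ k in a..b, q k))
      have h4 : |(v (Y a + 1) a - v (Y a) a) * (((Y b : ℝ) - Y a) - ∫ k in a..b, q k)|
          ≤ 2 * C * N + 2 * C * (K * (b - a)) := by
        rw [mul_sub]
        refine (abs_sub _ _).trans (add_le_add ?_ hδq)
        rw [abs_mul, abs_of_nonneg (zero_le_one.trans hY1)]
        exact mul_le_mul hδ hYN (zero_le_one.trans hY1) (by positivity)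
      have h5 : (2 * C + 4 * C * K) * (b - a) * 1
          ≤ (2 * C + 4 * C * K) * (b - a) * ((Y b : ℝ) - Y a) :=
        mul_le_mul_of_nonneg_left hY1 (by positivity)
      have h6 : 0 ≤ C * (b - a) := by positivity
      linarith

end Dynkin

/-! ### Dynkin's formula -/

section DynkinFormula

variable {Ω : Type*} [mΩ : MeasurableSpace Ω] {P : Measure Ω} [IsProbabilityMeasure P]
  {ℱ : Filtration ℝ≥0 mΩ} {X : ℝ≥0 → Ω → ℕ} {q : ℝ → Ω → ℝ} {K : ℝ} {N : ℕ}

/-- A bounded factor known at time `a` can be taken out of the conditional expectation, where the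
increment has mean zero. -/
lemma integral_mul_martingale_increment_eq_zero {Z : ℝ≥0 → Ω → ℝ} (hZ : Martingale Z ℱ P)
    {a b : ℝ≥0} (hab : a ≤ b) {g : Ω → ℝ} (hg : StronglyMeasurable[ℱ a] g) {B : ℝ}
    (hB : ∀ ω, |g ω| ≤ B) :
    Integrable (fun ω => g ω * (Z b ω - Z a ω)) P ∧ ∫ ω, g ω * (Z b ω - Z a ω) ∂P = 0 := by
  have hint : Integrable (Z b - Z a) P := (hZ.integrable b).sub (hZ.integrable a)
  have hprod : Integrable (fun ω => g ω * (Z b ω - Z a ω)) P :=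
    hint.bdd_mul (hg.mono (ℱ.le a)).aestronglyMeasurable (Filter.Eventually.of_forall hB)
  refine ⟨hprod, ?_⟩
  have h0 : P[Z b - Z a | ℱ a] =ᵐ[P] 0 := by
    filter_upwards [condExp_sub (hZ.integrable b) (hZ.integrable a) (ℱ a), hZ.2 a b hab,
      hZ.2 a a le_rfl] with ω h1 h2 h3
    rw [h1, Pi.sub_apply, h2, h3, sub_self, Pi.zero_apply]
  have h1 : P[g * (Z b - Z a) | ℱ a] =ᵐ[P] 0 := by
    filter_upwards [condExp_stronglyMeasurable_mul_of_bound (ℱ.le a) hg hint B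
      (Filter.Eventually.of_forall hB), h0] with ω h1 h2
    rw [h1, Pi.mul_apply, h2, Pi.zero_apply, mul_zero]
  calc ∫ ω, g ω * (Z b ω - Z a ω) ∂P = ∫ ω, (P[g * (Z b - Z a) | ℱ a]) ω ∂P :=
        (integral_condExp (ℱ.le a)).symm
    _ = 0 := by rw [integral_congr_ae h1]; simp

/-- Along grids of vanishing width, the number of grid intervals with more than one jump tends to
zero in mean. -/
lemma tendsto_integral_card_multiple_jumps (hX : ∀ k, Measurable (X k))
    (hmono : ∀ ω, Monotone fun k => X k ω)
    (hright : ∀ ω k, ContinuousWithinAt (fun j => X j ω) (Ici k) k)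
    (hjump : ∀ ω k, 0 < k → ∃ j < k, X k ω ≤ X j ω + 1)
    (hN : ∀ᵐ ω ∂P, ∀ k, X k ω ≤ N) {t : ℝ} (ht : 0 ≤ t) :
    Filter.Tendsto (fun n : ℕ => ∫ ω, ∑ i ∈ Finset.range (n + 1),
      (if X (i * (t / (n + 1))).toNNReal ω + 2 ≤ X ((i + 1 : ℕ) * (t / (n + 1))).toNNReal ω
        then (1 : ℝ) else 0) ∂P) Filter.atTop (nhds 0) := by
  have hlim := tendsto_integral_of_dominated_convergence (μ := P)
    (F := fun (n : ℕ) ω => ∑ i ∈ Finset.range (n + 1),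
      (if X (i * (t / (n + 1))).toNNReal ω + 2 ≤ X ((i + 1 : ℕ) * (t / (n + 1))).toNNReal ω
        then (1 : ℝ) else 0)) (f := fun _ => 0) (bound := fun _ => (N : ℝ))
    (fun n => by
      refine (Finset.measurable_sum _ fun i _ => ?_).aestronglyMeasurable
      refine Measurable.ite ?_ measurable_const measurable_const
      exact measurableSet_le ((measurable_of_countable (· + 2)).comp (hX _)) (hX _))
    (integrable_const _)
    (fun n => by
      filter_upwards [hN] with ω hω
      have hn : (0 : ℝ) ≤ t / (n + 1) := by positivity
      rw [Real.norm_eq_abs, abs_of_nonneg (Finset.sum_nonneg fun i _ => by split_ifs <;> simp)]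
      -- Each counted interval contributes at least one unit to a telescoping sum, so the count is
      -- dominated by the total number of jumps, at most `N`.
      have h1 : ∀ i : ℕ, (if X (i * (t / (n + 1))).toNNReal ω + 2
          ≤ X ((i + 1 : ℕ) * (t / (n + 1))).toNNReal ω then (1 : ℝ) else 0)
          ≤ (X ((i + 1 : ℕ) * (t / (n + 1))).toNNReal ω : ℝ)
            - X ((i : ℕ) * (t / (n + 1))).toNNReal ω := by
        intro i
        have hle : X (i * (t / (n + 1))).toNNReal ω
            ≤ X ((i + 1 : ℕ) * (t / (n + 1))).toNNReal ω := by
          refine hmono ω (Real.toNNReal_le_toNNReal (mul_le_mul_of_nonneg_right ?_ hn))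
          push_cast; linarith
        split_ifs with h
        · have : ((X (i * (t / (n + 1))).toNNReal ω + 2 : ℕ) : ℝ)
            ≤ X ((i + 1 : ℕ) * (t / (n + 1))).toNNReal ω := by exact_mod_cast h
          push_cast at this ⊢; linarith
        · have : ((X (i * (t / (n + 1))).toNNReal ω : ℕ) : ℝ)
            ≤ X ((i + 1 : ℕ) * (t / (n + 1))).toNNReal ω := by exact_mod_cast hle
          push_cast at this ⊢; linarith
      refine (Finset.sum_le_sum fun i _ => h1 i).trans ?_
      rw [Finset.sum_range_sub (fun i : ℕ => (X ((i : ℕ) * (t / (n + 1))).toNNReal ω : ℝ))]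
      have h2 : (X (((n + 1 : ℕ) : ℝ) * (t / (n + 1))).toNNReal ω : ℝ) ≤ N := by
        exact_mod_cast hω _
      have h3 : (0 : ℝ) ≤ X (((0 : ℕ) : ℝ) * (t / (n + 1))).toNNReal ω := Nat.cast_nonneg _
      linarith)
    (by
      refine Filter.Eventually.of_forall fun ω => ?_
      obtain ⟨δ, hδ, h⟩ := exists_forall_le_add_one_of_unit_jumps (hmono ω) (hright ω) (hjump ω)
        t.toNNReal
      have hto : Filter.Tendsto (fun n : ℕ => t / ((n : ℝ) + 1)) Filter.atTop (nhds 0) :=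
        Filter.Tendsto.div_atTop tendsto_const_nhds
          (Filter.tendsto_atTop_add_const_right _ _ tendsto_natCast_atTop_atTop)
      -- Once the grid is finer than the `δ` of this particular path, the count is exactly zero.
      refine tendsto_const_nhds.congr' ?_
      filter_upwards [hto.eventually (gt_mem_nhds hδ)] with n hn
      have hn0 : (0 : ℝ) ≤ t / (n + 1) := by positivity
      refine (Finset.sum_eq_zero fun i hi => ?_).symm
      rw [if_neg]
      have hi' : (i : ℝ) ≤ n := by exact_mod_cast Nat.lt_succ_iff.1 (Finset.mem_range.1 hi)
      have hstep : (i : ℝ) * (t / (n + 1)) ≤ (i + 1 : ℕ) * (t / (n + 1)) :=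
        mul_le_mul_of_nonneg_right (by push_cast; linarith) hn0
      have hlast : (i : ℝ) * (t / (n + 1)) ≤ t := by
        have h1 : (i : ℝ) * (t / (n + 1)) ≤ (n + 1 : ℝ) * (t / (n + 1)) :=
          mul_le_mul_of_nonneg_right (by linarith) hn0
        rwa [mul_div_cancel₀ t (by positivity)] at h1
      have := h _ (Real.toNNReal_le_toNNReal hlast) _ (Real.toNNReal_le_toNNReal hstep) (by
        rw [NNReal.dist_eq, Real.coe_toNNReal _ (by positivity), Real.coe_toNNReal _ (by positivity)]
        rw [← sub_mul]
        push_cast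
        rw [add_sub_cancel_left, one_mul, abs_of_nonneg hn0]
        exact hn)
      omega)
  simpa using hlim

/-- Dynkin's formula for a bounded counting process with intensity `q`. -/
theorem integral_increment_sub_drift_eq_zero (hX : Adapted ℱ X)
    (hmono : ∀ ω, Monotone fun k => X k ω)
    (hright : ∀ ω k, ContinuousWithinAt (fun j => X j ω) (Ici k) k)
    (hjump : ∀ ω k, 0 < k → ∃ j < k, X k ω ≤ X j ω + 1)
    (hN : ∀ᵐ ω ∂P, ∀ k, X k ω ≤ N)
    (hqm : Measurable fun p : ℝ × Ω => q p.1 p.2) (hq : ∀ k ω, 0 ≤ q k ω) (hqK : ∀ k ω, q k ω ≤ K)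
    (hM : Martingale (fun (k : ℝ≥0) ω => (X k ω : ℝ) - ∫ j in (0 : ℝ)..(k : ℝ), q j ω) ℱ P)
    {v v' : ℕ → ℝ → ℝ} {C t : ℝ} (ht : 0 ≤ t) (hv : ∀ y k, |v y k| ≤ C)
    (hv' : ∀ y k, |v' y k| ≤ C) (hvm : ∀ y, Measurable (v y)) (hvm' : ∀ y, Measurable (v' y))
    (hftc : ∀ y a b, 0 ≤ a → a ≤ b → b ≤ t → v y b - v y a = ∫ k in a..b, v' y k) :
    Integrable (fun ω => v (X t.toNNReal ω) t - v (X 0 ω) 0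
        - ∫ k in (0 : ℝ)..t, drift v v' (X k.toNNReal ω) (q k ω) k) P ∧
      ∫ ω, (v (X t.toNNReal ω) t - v (X 0 ω) 0
        - ∫ k in (0 : ℝ)..t, drift v v' (X k.toNNReal ω) (q k ω) k) ∂P = 0 := by
  obtain ⟨ω₀⟩ : Nonempty Ω := nonempty_of_isProbabilityMeasure P
  have hC : 0 ≤ C := (abs_nonneg _).trans (hv 0 0)
  have hK : 0 ≤ K := (hq 0 ω₀).trans (hqK 0 ω₀)
  have hXm : ∀ k, Measurable (X k) := fun k => (hX k).mono (ℱ.le k) le_rfl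
  have hYm : Measurable fun p : ℝ × Ω => X p.1.toNNReal p.2 :=
    (measurable_uncurry_of_monotone_right_continuous hXm hmono hright).comp
      ((measurable_real_toNNReal.comp measurable_fst).prodMk measurable_snd)
  have hdm : Measurable fun p : ℝ × Ω => drift v v' (X p.1.toNNReal p.2) (q p.1 p.2) p.1 :=
    measurable_drift hvm hvm' hYm hqm measurable_fst
  have hdb : ∀ k ω, |drift v v' (X k.toNNReal ω) (q k ω) k| ≤ C + 2 * C * K :=
    fun k ω => abs_drift_le hv hv' (hq k ω) (hqK k ω) _ _
  set W : Ω → ℝ := fun ω => v (X t.toNNReal ω) t - v (X 0 ω) 0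
    - ∫ k in (0 : ℝ)..t, drift v v' (X k.toNNReal ω) (q k ω) k with hW
  have hvX : ∀ k a, Integrable (fun ω => v (X k ω) a) P := fun k a =>
    Integrable.of_bound (C := C)
      ((measurable_of_countable fun y => v y a).comp (hXm k)).aestronglyMeasurable
      (Filter.Eventually.of_forall fun ω => hv _ _)
  have hWi : Integrable W P :=
    ((hvX _ _).sub (hvX _ _)).sub (integrable_intervalIntegral_of_abs_le hdm hdb 0 t)
  refine ⟨hWi, ?_⟩
  have hqI : ∀ ω a b, IntervalIntegrable (fun k => q k ω) volume a b := fun ω =>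
    intervalIntegrable_of_abs_le (hqm.comp (measurable_id.prodMk measurable_const)) (C := K)
      (fun k => by rw [abs_of_nonneg (hq k ω)]; exact hqK k ω)
  have hdI : ∀ ω a b, IntervalIntegrable
      (fun k => drift v v' (X k.toNNReal ω) (q k ω) k) volume a b := fun ω =>
    intervalIntegrable_of_abs_le (hdm.comp (measurable_id.prodMk measurable_const))
      (fun k => hdb k ω)
  have hmart : ∀ a b : ℝ, 0 ≤ a → a ≤ b →
      Integrable (fun ω => (v (X a.toNNReal ω + 1) a - v (X a.toNNReal ω) a) *
        (((X b.toNNReal ω : ℝ) - X a.toNNReal ω) - ∫ k in a..b, q k ω)) P ∧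
      ∫ ω, (v (X a.toNNReal ω + 1) a - v (X a.toNNReal ω) a) *
        (((X b.toNNReal ω : ℝ) - X a.toNNReal ω) - ∫ k in a..b, q k ω) ∂P = 0 := by
    intro a b ha hab
    have := integral_mul_martingale_increment_eq_zero hM (Real.toNNReal_le_toNNReal hab)
      (g := fun ω => v (X a.toNNReal ω + 1) a - v (X a.toNNReal ω) a)
      ((measurable_of_countable fun y => v (y + 1) a - v y a).comp (hX _)).stronglyMeasurable
      (B := 2 * C) (fun ω => abs_sub_le_two_mul (hv _ _) (hv _ _))
    have e : ∀ ω, ((X b.toNNReal ω : ℝ) - X a.toNNReal ω) - (∫ k in a..b, q k ω)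
        = ((X b.toNNReal ω : ℝ) - ∫ j in (0 : ℝ)..(b.toNNReal : ℝ), q j ω)
          - ((X a.toNNReal ω : ℝ) - ∫ j in (0 : ℝ)..(a.toNNReal : ℝ), q j ω) := by
      intro ω
      rw [Real.coe_toNNReal _ ha, Real.coe_toNNReal _ (ha.trans hab),
        ← intervalIntegral.integral_interval_sub_left (hqI ω 0 b) (hqI ω 0 a)]
      ring
    simp only [e]
    exact this
  have hbound : ∀ n : ℕ, |∫ ω, W ω ∂P| ≤
      (2 * C * K * t ^ 2 + (2 * C + 4 * C * K) * t * N) / (n + 1)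
        + (2 * C + 2 * C * N) * ∫ ω, ∑ i ∈ Finset.range (n + 1),
      (if X (i * (t / (n + 1))).toNNReal ω + 2 ≤ X ((i + 1 : ℕ) * (t / (n + 1))).toNNReal ω
        then (1 : ℝ) else 0) ∂P := by
    intro n
    have hn1 : (0 : ℝ) < n + 1 := by positivity
    set h : ℝ := t / (n + 1) with hh
    have hh0 : 0 ≤ h := by positivity
    have hnh : ((n + 1 : ℕ) : ℝ) * h = t := by
      push_cast; rw [hh, mul_div_cancel₀ t hn1.ne']
    have hpos : ∀ i : ℕ, (0 : ℝ) ≤ i * h := fun i => by positivity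
    have hstep : ∀ i : ℕ, (i : ℝ) * h ≤ (i + 1 : ℕ) * h := fun i =>
      mul_le_mul_of_nonneg_right (by push_cast; linarith) hh0
    have hwid : ∀ i : ℕ, ((i + 1 : ℕ) : ℝ) * h - i * h = h := fun i => by push_cast; ring
    set m : ℕ → Ω → ℝ := fun i ω => (v (X (i * h).toNNReal ω + 1) (i * h)
      - v (X (i * h).toNNReal ω) (i * h)) * (((X ((i + 1 : ℕ) * h).toNNReal ω : ℝ)
        - X (i * h).toNNReal ω) - ∫ k in (i * h)..((i + 1 : ℕ) * h), q k ω) with hm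
    have hmi : ∀ i ∈ Finset.range (n + 1), Integrable (m i) P := fun i _ =>
      (hmart _ _ (hpos i) (hstep i)).1
    have hsum : ∫ ω, (∑ i ∈ Finset.range (n + 1), m i ω) ∂P = 0 := by
      rw [integral_finsetSum _ hmi]
      exact Finset.sum_eq_zero fun i _ => (hmart _ _ (hpos i) (hstep i)).2
    -- Subtracting the mean-zero terms `m i` leaves only the expansion errors. As `W` does not
    -- depend on `n`, its mean is zero once these errors vanish in the limit.
    have hW' : ∫ ω, W ω ∂P = ∫ ω, (W ω - ∑ i ∈ Finset.range (n + 1), m i ω) ∂P := by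
      rw [integral_sub hWi (integrable_finsetSum _ hmi), hsum, sub_zero]
    have hBi : Integrable (fun ω => ∑ i ∈ Finset.range (n + 1),
        (if X (i * h).toNNReal ω + 2 ≤ X ((i + 1 : ℕ) * h).toNNReal ω
          then (1 : ℝ) else 0)) P := by
      refine integrable_finsetSum _ fun i _ => Integrable.of_bound (C := 1) ?_ ?_
      · refine (Measurable.ite ?_ measurable_const measurable_const).aestronglyMeasurable
        exact measurableSet_le ((measurable_of_countable (· + 2)).comp (hXm _)) (hXm _)
      · exact Filter.Eventually.of_forall fun ω => by split_ifs <;> simp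
    rw [hW', ← integral_const_mul, ← Real.norm_eq_abs]
    have hint : Integrable (fun ω => (2 * C * K * t ^ 2 + (2 * C + 4 * C * K) * t * N) / (n + 1)
        + (2 * C + 2 * C * N) * ∑ i ∈ Finset.range (n + 1),
        (if X (i * h).toNNReal ω + 2 ≤ X ((i + 1 : ℕ) * h).toNNReal ω
          then (1 : ℝ) else 0)) P := (integrable_const _).add (hBi.const_mul _)
    have hfin := norm_integral_le_of_norm_le (μ := P)
      (f := fun ω => W ω - ∑ i ∈ Finset.range (n + 1), m i ω) hint (by
        filter_upwards [hN] with ω hω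
        have hWs : W ω = ∑ i ∈ Finset.range (n + 1),
            (v (X ((i + 1 : ℕ) * h).toNNReal ω) ((i + 1 : ℕ) * h)
              - v (X (i * h).toNNReal ω) (i * h)
              - ∫ k in (i * h)..((i + 1 : ℕ) * h),
                drift v v' (X k.toNNReal ω) (q k ω) k) := by
          rw [Finset.sum_sub_distrib,
            Finset.sum_range_sub (fun i : ℕ => v (X (i * h).toNNReal ω) (i * h)),
            intervalIntegral.sum_integral_adjacent_intervals (a := fun i : ℕ => (i : ℝ) * h)
              (fun i _ => hdI ω _ _), hnh]
          simp [hW]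
        rw [hWs, ← Finset.sum_sub_distrib, Real.norm_eq_abs]
        refine (Finset.abs_sum_le_sum_abs _ _).trans ?_
        refine (Finset.sum_le_sum fun i hi => abs_increment_sub_drift_le (K := K) (N := N) hv hv'
          hvm hvm' hftc (Y := fun k => X k.toNNReal ω)
          (fun a b hab => hmono ω (Real.toNNReal_le_toNNReal hab)) (fun k => hω _)
          (hqm.comp (measurable_id.prodMk measurable_const)) (fun k => hq k ω) (fun k => hqK k ω)
          (hpos i) (hstep i) ?_).trans ?_
        · rw [← hnh]
          exact mul_le_mul_of_nonneg_right
            (by exact_mod_cast Nat.succ_le_of_lt (Finset.mem_range.1 hi)) hh0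
        · simp only [hwid]
          rw [Finset.sum_add_distrib, Finset.sum_add_distrib, ← Finset.mul_sum, ← Finset.mul_sum,
            Finset.sum_range_sub (fun i : ℕ => (X (i * h).toNNReal ω : ℝ)), Finset.sum_const,
            Finset.card_range, nsmul_eq_mul]
          refine add_le_add ?_ (Finset.mul_sum _ _ _).ge
          have h1 : (X (((n + 1 : ℕ) : ℝ) * h).toNNReal ω : ℝ)
              - X (((0 : ℕ) : ℝ) * h).toNNReal ω ≤ N := by
            have h2 : (X (((n + 1 : ℕ) : ℝ) * h).toNNReal ω : ℝ) ≤ N := by exact_mod_cast hω _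
            have h3 : (0 : ℝ) ≤ X (((0 : ℕ) : ℝ) * h).toNNReal ω := Nat.cast_nonneg _
            linarith
          have h4 : (2 * C + 4 * C * K) * h * ((X (((n + 1 : ℕ) : ℝ) * h).toNNReal ω : ℝ)
              - X (((0 : ℕ) : ℝ) * h).toNNReal ω) ≤ (2 * C + 4 * C * K) * h * N :=
            mul_le_mul_of_nonneg_left h1 (by positivity)
          refine (add_le_add le_rfl h4).trans (le_of_eq ?_)
          rw [hh]
          push_cast
          field_simp)
    rwa [integral_add (integrable_const _) (hBi.const_mul _), integral_const, probReal_univ,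
      one_smul] at hfin
  have hlim : Filter.Tendsto (fun n : ℕ =>
      (2 * C * K * t ^ 2 + (2 * C + 4 * C * K) * t * N) / ((n : ℝ) + 1)
        + (2 * C + 2 * C * N) * ∫ ω, ∑ i ∈ Finset.range (n + 1),
      (if X (i * (t / (n + 1))).toNNReal ω + 2 ≤ X ((i + 1 : ℕ) * (t / (n + 1))).toNNReal ω
        then (1 : ℝ) else 0) ∂P) Filter.atTop (nhds (0 + (2 * C + 2 * C * N) * 0)) :=
    (Filter.Tendsto.div_atTop tendsto_const_nhds
      (Filter.tendsto_atTop_add_const_right _ _ tendsto_natCast_atTop_atTop)).add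
      ((tendsto_integral_card_multiple_jumps hXm hmono hright hjump hN ht).const_mul _)
  rw [mul_zero, add_zero] at hlim
  exact abs_nonpos_iff.1 (ge_of_tendsto' hlim hbound)

end DynkinFormula

/-! ### Verification: profits compared with a solution of the HJB system -/

lemma predictable_le_prod {Ω : Type*} [mΩ : MeasurableSpace Ω] (ℱ : Filtration ℝ≥0 mΩ) :
    ℱ.predictable ≤ (inferInstance : MeasurableSpace (ℝ≥0 × Ω)) :=
  measurableSpace_le_predictable_of_measurableSet
    (fun _ hA => (measurableSet_singleton _).prod (ℱ.le _ _ hA))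
    (fun _ _ hA => measurableSet_Ioi.prod (ℱ.le _ _ hA))

namespace ProductionModel

variable (M : ProductionModel)

/-- Outside the set of rates `g` is arbitrary, so measurability is borrowed from a continuous
extension that agrees with `g` on the values of `s`. -/
lemma measurable_comp_of_continuousOn_rates {α : Type*} [MeasurableSpace α] {g : ℝ → ℝ}
    (hg : ContinuousOn g (Icc 0 M.maxRate)) {s : α → ℝ} (hs : Measurable s)
    (hmem : ∀ a, s a ∈ M.rates) : Measurable fun a => g (s a) := by
  have h : Continuous (IccExtend M.maxRate_pos.le ((Icc 0 M.maxRate).domRestrict g)) :=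
    (continuousOn_iff_continuous_domRestrict.1 hg).Icc_extend'
  have e : (fun a => g (s a)) =
      fun a => IccExtend M.maxRate_pos.le ((Icc 0 M.maxRate).domRestrict g) (s a) := by
    ext a
    exact (IccExtend_of_mem M.maxRate_pos.le ((Icc 0 M.maxRate).domRestrict g) (hmem a)).symm
  rw [e]
  exact h.measurable.comp hs

lemma exists_abs_r_le : ∃ R, ∀ s ∈ M.rates, |M.r s| ≤ R :=
  isCompact_Icc.exists_bound_of_continuousOn M.r_continuousOn

lemma abs_revenueRate_le {R : ℝ} (hR : ∀ s ∈ M.rates, |M.r s| ≤ R) (y : ℕ) {s : ℝ}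
    (hs : s ∈ M.rates) : |M.revenueRate y s| ≤ R := by
  unfold revenueRate
  split_ifs
  · exact hR s hs
  · rw [abs_zero]; exact (abs_nonneg _).trans (hR s hs)

/-- The rate at which a production rate falls short of the maximum in the HJB equation, with `u`
time units to go at level `y`. -/
def hjbGap (J : ℕ → ℝ → ℝ) (y : ℕ) (s u : ℝ) : ℝ :=
  if y < M.ξ then
    M.r s - M.lam * M.f s * (J y u - J (y + 1) u) - M.hamiltonian (J y u - J (y + 1) u)
  else 0

lemma hjbGap_nonpos (J : ℕ → ℝ → ℝ) (y : ℕ) {s : ℝ} (hs : s ∈ M.rates) (u : ℝ) :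
    M.hjbGap J y s u ≤ 0 := by
  unfold hjbGap
  split_ifs
  · exact sub_nonpos.2 (M.le_hamiltonian hs _)
  · rfl

/-- The profit-to-go process associated with `J` on the horizon `t`, as a function of level and
elapsed time. -/
def toGo (J : ℕ → ℝ → ℝ) {t : ℝ} (ht : 0 ≤ t) (y : ℕ) (k : ℝ) : ℝ :=
  if y ≤ M.ξ then J y (projIcc 0 t ht (t - k)) else 0

/-- The time derivative of `toGo`. -/
def toGoDeriv (J : ℕ → ℝ → ℝ) {t : ℝ} (ht : 0 ≤ t) (y : ℕ) (k : ℝ) : ℝ :=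
  if y < M.ξ then
    -M.hamiltonian (J y (projIcc 0 t ht (t - k)) - J (y + 1) (projIcc 0 t ht (t - k)))
  else 0

section ToGo

variable {M} {J : ℕ → ℝ → ℝ} {t : ℝ} (ht : 0 ≤ t)

lemma continuous_comp_projIcc_sub {g : ℝ → ℝ} (hg : ContinuousOn g (Icc 0 t)) :
    Continuous fun k : ℝ => g (projIcc 0 t ht (t - k)) :=
  hg.comp_continuous (continuous_subtype_val.comp
    (continuous_projIcc.comp (continuous_const.sub continuous_id))) fun _ => Subtype.coe_prop _

lemma SolvesHJB.continuousOn_hamiltonian (h : M.SolvesHJB (Icc 0 t) J) {y : ℕ} (hy : y < M.ξ) :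
    ContinuousOn (fun u => M.hamiltonian (J y u - J (y + 1) u)) (Icc 0 t) :=
  M.lipschitzWith_hamiltonian.continuous.comp_continuousOn
    ((h.continuousOn hy.le).sub (h.continuousOn hy))

lemma SolvesHJB.continuous_toGo (h : M.SolvesHJB (Icc 0 t) J) (y : ℕ) :
    Continuous (M.toGo J ht y) := by
  unfold toGo
  split_ifs with hy
  · exact continuous_comp_projIcc_sub ht (h.continuousOn hy)
  · exact continuous_const

lemma SolvesHJB.continuous_toGoDeriv (h : M.SolvesHJB (Icc 0 t) J) (y : ℕ) :
    Continuous (M.toGoDeriv J ht y) := by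
  unfold toGoDeriv
  split_ifs with hy
  · exact (continuous_comp_projIcc_sub ht (h.continuousOn_hamiltonian hy)).neg
  · exact continuous_const

/-- Dynkin's formula asks for bounds at all levels and all real times. Clamping time to `[0, t]` and
setting the functions to zero above `ξ` reduces this to compactness and finitely many levels. -/
lemma SolvesHJB.exists_abs_toGo_le (h : M.SolvesHJB (Icc 0 t) J) :
    ∃ C, (∀ y k, |M.toGo J ht y k| ≤ C) ∧ ∀ y k, |M.toGoDeriv J ht y k| ≤ C := by
  have key : ∀ y, ∃ C, 0 ≤ C ∧ ∀ k, |M.toGo J ht y k| ≤ C ∧ |M.toGoDeriv J ht y k| ≤ C := by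
    intro y
    rcases lt_trichotomy y M.ξ with hy | hy | hy
    · obtain ⟨A, hA⟩ := isCompact_Icc.exists_bound_of_continuousOn (h.continuousOn hy.le)
      obtain ⟨B, hB⟩ := isCompact_Icc.exists_bound_of_continuousOn (h.continuousOn_hamiltonian hy)
      refine ⟨max A B, ((norm_nonneg _).trans (hA 0 ⟨le_rfl, ht⟩)).trans (le_max_left _ _),
        fun k => ⟨?_, ?_⟩⟩
      · rw [toGo, if_pos hy.le]
        exact (hA _ (Subtype.coe_prop _)).trans (le_max_left _ _)
      · rw [toGoDeriv, if_pos hy, abs_neg]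
        exact (hB _ (Subtype.coe_prop _)).trans (le_max_right _ _)
    · obtain ⟨A, hA⟩ := isCompact_Icc.exists_bound_of_continuousOn (h.continuousOn hy.le)
      have hA0 : 0 ≤ A := (norm_nonneg _).trans (hA 0 ⟨le_rfl, ht⟩)
      refine ⟨A, hA0, fun k => ⟨?_, ?_⟩⟩
      · rw [toGo, if_pos hy.le]
        exact hA _ (Subtype.coe_prop _)
      · rw [toGoDeriv, if_neg hy.not_lt, abs_zero]
        exact hA0
    · refine ⟨0, le_rfl, fun k => ⟨?_, ?_⟩⟩
      · rw [toGo, if_neg hy.not_ge, abs_zero]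
      · rw [toGoDeriv, if_neg hy.not_gt, abs_zero]
  choose C hC0 hC using key
  have hle : ∀ y ≤ M.ξ, C y ≤ ∑ z ∈ Finset.range (M.ξ + 1), C z := fun y hy =>
    Finset.single_le_sum (f := C) (fun z _ => hC0 z) (Finset.mem_range.2 (by omega))
  have hS : 0 ≤ ∑ z ∈ Finset.range (M.ξ + 1), C z := Finset.sum_nonneg fun z _ => hC0 z
  refine ⟨∑ z ∈ Finset.range (M.ξ + 1), C z, fun y k => ?_, fun y k => ?_⟩
  · by_cases hy : y ≤ M.ξ
    · exact ((hC y k).1).trans (hle y hy)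
    · rw [toGo, if_neg hy, abs_zero]; exact hS
  · by_cases hy : y ≤ M.ξ
    · exact ((hC y k).2).trans (hle y hy)
    · rw [toGoDeriv, if_neg (by omega), abs_zero]; exact hS

/-- The clamp is inactive in the open interval `(0, t)`, where the HJB equation supplies the
derivative; the sign comes from reversing time. -/
lemma SolvesHJB.toGo_sub_toGo (h : M.SolvesHJB (Icc 0 t) J) (y : ℕ) {a b : ℝ} (ha : 0 ≤ a)
    (hab : a ≤ b) (hb : b ≤ t) :
    M.toGo J ht y b - M.toGo J ht y a = ∫ k in a..b, M.toGoDeriv J ht y k := by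
  symm
  refine intervalIntegral.integral_eq_sub_of_hasDerivAt_of_le hab
    (h.continuous_toGo ht y).continuousOn (fun k hk => ?_)
    ((h.continuous_toGoDeriv ht y).intervalIntegrable _ _)
  have hk' : k ∈ Ioo 0 t := ⟨ha.trans_lt hk.1, hk.2.trans_le hb⟩
  have hmem : t - k ∈ Icc 0 t := ⟨by linarith [hk'.2], by linarith [hk'.1]⟩
  have hnhds : Icc 0 t ∈ nhds (t - k) := Icc_mem_nhds (by linarith [hk'.2]) (by linarith [hk'.1])
  by_cases hy : y ≤ M.ξ
  · have hev : M.toGo J ht y =ᶠ[nhds k] fun k => J y (t - k) := by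
      filter_upwards [Ioo_mem_nhds hk'.1 hk'.2] with j hj
      rw [toGo, if_pos hy, projIcc_of_mem ht ⟨by linarith [hj.2], by linarith [hj.1]⟩]
    refine HasDerivAt.congr_of_eventuallyEq ?_ hev
    rcases Nat.eq_or_lt_of_le hy with rfl | hlt
    · rw [toGoDeriv, if_neg (lt_irrefl _)]
      have := ((h.failed _ hmem).hasDerivAt hnhds).comp_const_sub t k
      simpa using this
    · rw [toGoDeriv, if_pos hlt, projIcc_of_mem ht hmem]
      exact ((h.hasDerivWithinAt hlt hmem).hasDerivAt hnhds).comp_const_sub t k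
  · have e1 : M.toGo J ht y = fun _ => 0 := by ext; rw [toGo, if_neg hy]
    rw [e1, toGoDeriv, if_neg (by omega)]
    exact hasDerivAt_const _ _

end ToGo

namespace IsAdmissible

variable {M} {x : ℕ} {Ω : Type} [mΩ : MeasurableSpace Ω] {P : Measure Ω}
  {ℱ : Filtration ℝ≥0 mΩ} {X : ℝ≥0 → Ω → ℕ} {s : ℝ≥0 → Ω → ℝ}

lemma measurable_level (h : M.IsAdmissible x P ℱ X s) (k : ℝ≥0) : Measurable (X k) :=
  (h.adapted k).mono (ℱ.le k) le_rfl

lemma measurable_uncurry_level (h : M.IsAdmissible x P ℱ X s) :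
    Measurable fun p : ℝ × Ω => X p.1.toNNReal p.2 :=
  (measurable_uncurry_of_monotone_right_continuous h.measurable_level h.monotone
    h.right_continuous).comp ((measurable_real_toNNReal.comp measurable_fst).prodMk measurable_snd)

lemma measurable_uncurry_rate (h : M.IsAdmissible x P ℱ X s) :
    Measurable fun p : ℝ × Ω => s p.1.toNNReal p.2 :=
  (StronglyMeasurable.measurable (h.predictable.mono (predictable_le_prod ℱ))).comp
    ((measurable_real_toNNReal.comp measurable_fst).prodMk measurable_snd)

lemma measurable_uncurry_intensity (h : M.IsAdmissible x P ℱ X s) :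
    Measurable fun p : ℝ × Ω => M.lam * M.f (s p.1.toNNReal p.2) :=
  (M.measurable_comp_of_continuousOn_rates M.f_continuousOn h.measurable_uncurry_rate
    fun _ => h.rate_mem _ _).const_mul _

lemma measurable_uncurry_revenueRate (h : M.IsAdmissible x P ℱ X s) :
    Measurable fun p : ℝ × Ω => M.revenueRate (X p.1.toNNReal p.2) (s p.1.toNNReal p.2) :=
  Measurable.ite (measurableSet_lt h.measurable_uncurry_level measurable_const)
    (M.measurable_comp_of_continuousOn_rates M.r_continuousOn h.measurable_uncurry_rate
      fun _ => h.rate_mem _ _) measurable_const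

/-- The rate is only required to vanish strictly after failure, but the moment of failure is the
single possible exception and has measure zero. -/
lemma ae_ae_rate_eq_zero (h : M.IsAdmissible x P ℱ X s) :
    ∀ᵐ ω ∂P, ∀ᵐ k : ℝ, 0 < k → X k.toNNReal ω = M.ξ → s k.toNNReal ω = 0 := by
  filter_upwards [h.off_after_failure] with ω hoff
  have hsub : {k : ℝ | ¬ (0 < k → X k.toNNReal ω = M.ξ → s k.toNNReal ω = 0)}.Subsingleton := by
    intro a ha b hb
    simp only [mem_ofPred_eq, Classical.not_imp] at ha hb
    obtain ⟨ha, hXa, hsa⟩ := ha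
    obtain ⟨hb, hXb, hsb⟩ := hb
    rcases lt_trichotomy a b with hab | hab | hab
    · exact absurd (hoff _ _ ((Real.toNNReal_lt_toNNReal_iff hb).2 hab) hXa) hsb
    · exact hab
    · exact absurd (hoff _ _ ((Real.toNNReal_lt_toNNReal_iff ha).2 hab) hXb) hsa
  exact hsub.measure_zero volume

lemma integrable_profit [IsProbabilityMeasure P] (h : M.IsAdmissible x P ℱ X s) (t : ℝ) :
    Integrable (fun ω => (∫ k in (0 : ℝ)..t,
      M.revenueRate (X k.toNNReal ω) (s k.toNNReal ω)) - M.c (X t.toNNReal ω)) P := by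
  obtain ⟨R, hR⟩ := M.exists_abs_r_le
  refine (integrable_intervalIntegral_of_abs_le h.measurable_uncurry_revenueRate (C := R)
    (fun k ω => M.abs_revenueRate_le hR _ (h.rate_mem _ _)) 0 t).sub ?_
  refine Integrable.of_bound (C := M.c M.ξ)
    ((measurable_of_countable M.c).comp (h.measurable_level _)).aestronglyMeasurable ?_
  filter_upwards [h.level_le] with ω hω
  rw [Real.norm_eq_abs, abs_of_nonneg (M.c_nonneg _ (hω _))]
  exact M.c_monotoneOn (hω _) self_mem_Iic (hω _)

/-- The expected profit of a policy falls short of a solution of the HJB system by the expected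
accumulated gap. -/
theorem integrable_gap_and_expectedProfit_eq [IsProbabilityMeasure P]
    (h : M.IsAdmissible x P ℱ X s) {t : ℝ} (ht : 0 ≤ t) {J : ℕ → ℝ → ℝ}
    (hJ : M.SolvesHJB (Icc 0 t) J) :
    Integrable (fun ω => ∫ k in (0 : ℝ)..t,
      M.hjbGap J (X k.toNNReal ω) (s k.toNNReal ω) (t - k)) P ∧
    M.expectedProfit t P X s = J x t + ∫ ω, (∫ k in (0 : ℝ)..t,
      M.hjbGap J (X k.toNNReal ω) (s k.toNNReal ω) (t - k)) ∂P := by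
  obtain ⟨C, hC, hC'⟩ := hJ.exists_abs_toGo_le ht
  obtain ⟨R, hR⟩ := M.exists_abs_r_le
  have hvm := fun y => (hJ.continuous_toGo ht y).measurable
  have hvm' := fun y => (hJ.continuous_toGoDeriv ht y).measurable
  obtain ⟨hWi, hW0⟩ := integral_increment_sub_drift_eq_zero (P := P) (ℱ := ℱ) (X := X)
    (q := fun k ω => M.lam * M.f (s k.toNNReal ω)) (K := M.maxIntensity) (N := M.ξ)
    h.adapted h.monotone h.right_continuous h.unit_jumps h.level_le h.measurable_uncurry_intensity
    (fun k ω => M.intensity_nonneg (h.rate_mem _ _)) (fun k ω => M.intensity_le (h.rate_mem _ _))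
    h.intensity ht hC hC' hvm hvm' (fun y a b ha hab hb => hJ.toGo_sub_toGo ht y ha hab hb)
  have hZi := h.integrable_profit t
  -- Pathwise, profit minus the mean-zero Dynkin term minus `J x t` is the accumulated gap: the
  -- terminal costs cancel by the boundary condition.
  have hkey : (fun ω => ((∫ k in (0 : ℝ)..t, M.revenueRate (X k.toNNReal ω) (s k.toNNReal ω))
        - M.c (X t.toNNReal ω)) - (M.toGo J ht (X t.toNNReal ω) t - M.toGo J ht (X 0 ω) 0
        - ∫ k in (0 : ℝ)..t, drift (M.toGo J ht) (M.toGoDeriv J ht) (X k.toNNReal ω)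
          (M.lam * M.f (s k.toNNReal ω)) k) - J x t) =ᵐ[P]
      fun ω => ∫ k in (0 : ℝ)..t, M.hjbGap J (X k.toNNReal ω) (s k.toNNReal ω) (t - k) := by
    filter_upwards [h.level_le, h.ae_ae_rate_eq_zero] with ω hle hoff
    have e1 : M.toGo J ht (X t.toNNReal ω) t = -M.c (X t.toNNReal ω) := by
      rw [toGo, if_pos (hle _), sub_self, projIcc_left, hJ.boundary _ (hle _)]
    have e2 : M.toGo J ht (X 0 ω) 0 = J x t := by
      rw [toGo, if_pos (hle _), sub_zero, projIcc_right, h.start]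
    have hrev : IntervalIntegrable (fun k : ℝ => M.revenueRate (X k.toNNReal ω) (s k.toNNReal ω))
        volume 0 t := intervalIntegrable_of_abs_le
      (h.measurable_uncurry_revenueRate.comp (measurable_id.prodMk measurable_const))
      (fun k => M.abs_revenueRate_le hR _ (h.rate_mem _ _)) 0 t
    have hdr : IntervalIntegrable (fun k : ℝ => drift (M.toGo J ht) (M.toGoDeriv J ht)
        (X k.toNNReal ω) (M.lam * M.f (s k.toNNReal ω)) k) volume 0 t :=
      intervalIntegrable_of_abs_le (measurable_drift hvm hvm'
        (h.measurable_uncurry_level.comp (measurable_id.prodMk measurable_const))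
        (h.measurable_uncurry_intensity.comp (measurable_id.prodMk measurable_const))
        measurable_id) (fun k => abs_drift_le hC hC' (M.intensity_nonneg (h.rate_mem _ _))
          (M.intensity_le (h.rate_mem _ _)) _ _) 0 t
    rw [e1, e2]
    have e3 : ∀ a b c d : ℝ, a - b - (-b - d - c) - d = a + c := fun a b c d => by ring
    rw [e3, ← intervalIntegral.integral_add hrev hdr]
    refine intervalIntegral.integral_congr_ae ?_
    filter_upwards [hoff] with k hk hkt
    rw [uIoc_of_le ht] at hkt
    have hmem : t - k ∈ Icc 0 t := ⟨by linarith [hkt.2], by linarith [hkt.1]⟩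
    rcases Nat.eq_or_lt_of_le (hle k.toNNReal) with heq | hlt
    · rw [hk hkt.1 heq, heq, revenueRate, drift, toGoDeriv, hjbGap, M.f_zero]
      simp
    · rw [revenueRate, drift, toGoDeriv, hjbGap, toGo, toGo, if_pos hlt, if_pos hlt, if_pos hlt,
        if_pos hlt.le, if_pos (Nat.succ_le_of_lt hlt), projIcc_of_mem ht hmem]
      ring
  have hZW := hZi.sub hWi
  simp only [Pi.sub_def] at hZW
  have hint := (hZW.sub (integrable_const (J x t))).congr hkey
  refine ⟨hint, ?_⟩
  rw [← integral_congr_ae hkey, integral_sub hZW (integrable_const _),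
    integral_sub hZi hWi, hW0, integral_const, probReal_univ, one_smul]
  unfold expectedProfit
  ring

lemma expectedProfit_le [IsProbabilityMeasure P] (h : M.IsAdmissible x P ℱ X s)
    {t : ℝ} (ht : 0 ≤ t) {J : ℕ → ℝ → ℝ} (hJ : M.SolvesHJB (Icc 0 t) J) :
    M.expectedProfit t P X s ≤ J x t := by
  rw [(h.integrable_gap_and_expectedProfit_eq ht hJ).2, add_le_iff_nonpos_right]
  refine integral_nonpos fun ω => ?_
  rw [intervalIntegral.integral_of_le ht]
  exact integral_nonpos fun k => M.hjbGap_nonpos J _ (h.rate_mem _ _) _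

lemma le_expectedProfit [IsProbabilityMeasure P] (h : M.IsAdmissible x P ℱ X s)
    {t : ℝ} (ht : 0 ≤ t) {J : ℕ → ℝ → ℝ} (hJ : M.SolvesHJB (Icc 0 t) J) {η : ℝ}
    (hη : ∀ᵐ ω ∂P, -η ≤ ∫ k in (0 : ℝ)..t,
      M.hjbGap J (X k.toNNReal ω) (s k.toNNReal ω) (t - k)) :
    J x t - η ≤ M.expectedProfit t P X s := by
  obtain ⟨hi, he⟩ := h.integrable_gap_and_expectedProfit_eq ht hJ
  have := integral_mono_ae (integrable_const (-η)) hi hη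
  rw [integral_const, probReal_univ, one_smul] at this
  rw [he]
  linarith

end IsAdmissible

end ProductionModel

/-! ### Adjoining an independent exponential clock -/

section Martingale

lemma martingale_of_forall_setIntegral_eq {Ω ι : Type*} [Preorder ι] [mΩ : MeasurableSpace Ω]
    {P : Measure Ω} [IsFiniteMeasure P] {ℱ : Filtration ι mΩ} {Z : ι → Ω → ℝ}
    (hadp : StronglyAdapted ℱ Z) (hint : ∀ i, Integrable (Z i) P)
    (h : ∀ i j, i ≤ j → ∀ A, MeasurableSet[ℱ i] A → ∫ ω in A, Z i ω ∂P = ∫ ω in A, Z j ω ∂P) :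
    Martingale Z ℱ P :=
  ⟨hadp, fun i j hij => (ae_eq_condExp_of_forall_setIntegral_eq (ℱ.le i) (hint j)
    (fun _ _ _ => (hint i).integrableOn) (fun A hA _ => h i j hij A hA)
    (hadp i).aestronglyMeasurable).symm⟩

end Martingale

section SingleJump

/-- The compensated indicator that an exponential clock with value `e` has rung by operational
time `p`. -/
def compensatedJump (p e : ℝ) : ℝ := (if 0 < e ∧ e ≤ p then 1 else 0) - min (max e 0) p

/-- After the clock has rung, neither the indicator nor the compensator changes any more. -/
lemma compensatedJump_eq_of_le {p q e : ℝ} (hp : 0 ≤ p) (hpq : p ≤ q) (he : e ≤ p) :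
    compensatedJump q e = compensatedJump p e := by
  have h1 : max e 0 ≤ p := max_le he hp
  simp only [compensatedJump, min_eq_left h1, min_eq_left (h1.trans hpq), he, he.trans hpq]

lemma abs_compensatedJump_le {p : ℝ} (hp : 0 ≤ p) (e : ℝ) : |compensatedJump p e| ≤ 1 + p := by
  have h1 : 0 ≤ min (max e 0) p := le_min (le_max_right _ _) hp
  have h2 : min (max e 0) p ≤ p := min_le_right _ _
  unfold compensatedJump
  rw [abs_le]
  split_ifs <;> constructor <;> linarith

lemma measurable_compensatedJump {α : Type*} [MeasurableSpace α] {p e : α → ℝ} (hp : Measurable p)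
    (he : Measurable e) : Measurable fun a => compensatedJump (p a) (e a) :=
  (Measurable.ite ((measurableSet_lt measurable_const he).inter (measurableSet_le he hp))
    measurable_const measurable_const).sub ((he.max measurable_const).min hp)

/-- Ringing before `p` contributes the integral of `(1 - e) exp (-e)`, whose primitive `e exp (-e)`
gives `p exp (-p)`; the tail contributes the opposite amount. -/
lemma setIntegral_exp_mul_compensatedJump {p : ℝ} (hp : 0 ≤ p) :
    ∫ e in Ioi (0 : ℝ), Real.exp (-e) * compensatedJump p e = 0 := by
  have h1 : ∫ e in Ioc 0 p, Real.exp (-e) * compensatedJump p e = p * Real.exp (-p) := by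
    have e1 : ∫ e in Ioc 0 p, Real.exp (-e) * compensatedJump p e
        = ∫ e in Ioc 0 p, Real.exp (-e) * (1 - e) := by
      refine setIntegral_congr_fun measurableSet_Ioc fun e he => ?_
      simp only [compensatedJump, he.1, he.2, and_self, if_true, max_eq_left he.1.le,
        min_eq_left he.2]
    rw [e1, ← intervalIntegral.integral_of_le hp]
    have := intervalIntegral.integral_eq_sub_of_hasDerivAt (a := 0) (b := p)
      (f := fun e : ℝ => e * Real.exp (-e)) (f' := fun e => Real.exp (-e) * (1 - e))
      (fun e _ => by
        have := (hasDerivAt_id e).mul ((hasDerivAt_id e).neg.exp)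
        convert! this using 1
        simp; ring)
      ((by fun_prop : Continuous fun e : ℝ => Real.exp (-e) * (1 - e)).intervalIntegrable _ _)
    rw [this]; simp
  have h2' : ∀ e ∈ Ioi p, Real.exp (-e) * compensatedJump p e = -p * Real.exp (-e) := by
    intro e he
    have he' : p < e := he
    simp only [compensatedJump, he'.not_ge, and_false, if_false,
      min_eq_right (he'.le.trans (le_max_left e 0))]
    ring
  have h2 : ∫ e in Ioi p, Real.exp (-e) * compensatedJump p e = -p * Real.exp (-p) := by
    rw [setIntegral_congr_fun measurableSet_Ioi h2', integral_const_mul, integral_exp_neg_Ioi]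
  have hi : ∀ c : ℝ, IntegrableOn (fun e => Real.exp (-e)) (Ioi c) := fun c => by
    simpa using exp_neg_integrableOn_Ioi c one_pos
  rw [← Ioc_union_Ioi_eq_Ioi hp, setIntegral_union (Ioc_disjoint_Ioi le_rfl) measurableSet_Ioi,
    h1, h2]
  · ring
  · have hb : IntegrableOn (fun e => (1 + p) * Real.exp (-e)) (Ioc 0 p) :=
      ((hi 0).mono_set Ioc_subset_Ioi_self).const_mul _
    refine hb.mono' ?_ (Filter.Eventually.of_forall fun e => ?_)
    · exact ((Real.measurable_exp.comp measurable_neg).mul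
        (measurable_compensatedJump measurable_const measurable_id)).aestronglyMeasurable
    · rw [norm_mul, Real.norm_eq_abs, Real.norm_eq_abs, abs_of_pos (Real.exp_pos _), mul_comm]
      exact mul_le_mul_of_nonneg_right (abs_compensatedJump_le hp e) (Real.exp_pos _).le
  · exact (IntegrableOn.congr_fun ((hi p).const_mul (-p)) (fun e he => (h2' e he).symm)
      measurableSet_Ioi)

/-- The exponential distribution with unit rate makes the compensated jump centred. -/
lemma exists_unit_exponential : ∃ ν : Measure ℝ, IsProbabilityMeasure ν ∧ (∀ᵐ e ∂ν, 0 < e) ∧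
    ∀ p, 0 ≤ p → ∫ e, compensatedJump p e ∂ν = 0 := by
  have hm : Measurable fun e : ℝ => ENNReal.ofReal (Real.exp (-e)) := by fun_prop
  refine ⟨(volume.restrict (Ioi 0)).withDensity fun e => ENNReal.ofReal (Real.exp (-e)),
    ⟨?_⟩, ?_, fun p hp => ?_⟩
  · rw [withDensity_apply _ MeasurableSet.univ, Measure.restrict_univ,
      ← ofReal_integral_eq_lintegral_ofReal, integral_exp_neg_Ioi_zero, ENNReal.ofReal_one]
    · simpa [IntegrableOn] using exp_neg_integrableOn_Ioi 0 one_pos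
    · exact Filter.Eventually.of_forall fun e => (Real.exp_pos _).le
  · exact (withDensity_absolutelyContinuous _ _).ae_le (ae_restrict_mem measurableSet_Ioi)
  · rw [integral_withDensity_eq_integral_toReal_smul hm
      (Filter.Eventually.of_forall fun e => ENNReal.ofReal_lt_top)]
    simp only [ENNReal.toReal_ofReal (Real.exp_pos _).le, smul_eq_mul]
    exact setIntegral_exp_mul_compensatedJump hp

variable {Ω : Type*} [mΩ : MeasurableSpace Ω]

/-- The events in `Ω × ℝ` that are not informative on the second coordinate where that exceeds the
threshold `p`. -/
@[reducible]
def censored (p : Ω → ℝ) : MeasurableSpace (Ω × ℝ) where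
  MeasurableSet' A := MeasurableSet A ∧
    ∀ ω e e', p ω < e → p ω < e' → ((ω, e) ∈ A ↔ (ω, e') ∈ A)
  measurableSet_empty := ⟨MeasurableSet.empty, fun _ _ _ _ _ => Iff.rfl⟩
  measurableSet_compl A hA :=
    ⟨hA.1.compl, fun ω e e' he he' => not_congr (hA.2 ω e e' he he')⟩
  measurableSet_iUnion A hA := by
    refine ⟨MeasurableSet.iUnion fun i => (hA i).1, fun ω e e' he he' => ?_⟩
    simp only [mem_iUnion]
    exact exists_congr fun i => (hA i).2 ω e e' he he'

lemma measurable_censored {β : Type*} [MeasurableSpace β] {p : Ω → ℝ} {g : Ω × ℝ → β}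
    (hg : Measurable g) (h : ∀ ω e e', p ω < e → p ω < e' → g (ω, e) = g (ω, e')) :
    Measurable[censored p] g := fun B hB =>
  ⟨hg hB, fun ω e e' he he' => by rw [mem_preimage, mem_preimage, h ω e e' he he']⟩

/-- The history of a process on `Ω` up to time `T` that continues with an independent clock, of
which the value is revealed as the operational time `p` passes it. -/
def clockFiltration (ℱ : Filtration ℝ≥0 mΩ) (T : ℝ≥0) (p : ℝ≥0 → Ω → ℝ)
    (hp : ∀ ω, Monotone fun k => p k ω) :
    Filtration ℝ≥0 (inferInstance : MeasurableSpace (Ω × ℝ)) where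
  -- After `T` every event of `Ω` is revealed at once. In the intended use the old martingale is
  -- constant from `T` on, and the clock is independent of `Ω`, so no martingale property is lost.
  seq k := if k ≤ T then (ℱ k).comap Prod.fst else censored (p k)
  mono' := by
    intro j k hjk
    by_cases hk : k ≤ T
    · simp only [if_pos hk, if_pos (hjk.trans hk)]
      exact MeasurableSpace.comap_mono (ℱ.mono hjk)
    · by_cases hj : j ≤ T
      · simp only [if_pos hj, if_neg hk]
        rintro _ ⟨B, hB, rfl⟩
        exact ⟨measurable_fst (ℱ.le j _ hB), fun _ _ _ _ _ => Iff.rfl⟩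
      · simp only [if_neg hj, if_neg hk]
        exact fun A hA => ⟨hA.1, fun ω e e' he he' =>
          hA.2 ω e e' ((hp ω hjk).trans_lt he) ((hp ω hjk).trans_lt he')⟩
  le' k := by
    by_cases hk : k ≤ T
    · simp only [if_pos hk]
      rintro _ ⟨B, hB, rfl⟩
      exact measurable_fst (ℱ.le k _ hB)
    · simp only [if_neg hk]
      exact fun A hA => hA.1

section ClockFiltration

variable {ℱ : Filtration ℝ≥0 mΩ} {T : ℝ≥0} {p : ℝ≥0 → Ω → ℝ} {hp : ∀ ω, Monotone fun k => p k ω}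

lemma clockFiltration_of_le {k : ℝ≥0} (hk : k ≤ T) :
    clockFiltration ℱ T p hp k = (ℱ k).comap Prod.fst := if_pos hk

lemma clockFiltration_of_lt {k : ℝ≥0} (hk : T < k) :
    clockFiltration ℱ T p hp k = censored (p k) := if_neg hk.not_ge

lemma measurable_fst_clockFiltration (k : ℝ≥0) :
    Measurable[clockFiltration ℱ T p hp k, ℱ k] (Prod.fst : Ω × ℝ → Ω) := by
  rcases le_or_gt k T with hk | hk
  · rw [clockFiltration_of_le hk]
    exact comap_measurable _
  · rw [clockFiltration_of_lt hk]
    exact fun B hB => ⟨measurable_fst (ℱ.le k _ hB), fun _ _ _ _ _ => Iff.rfl⟩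

/-- Events up to `T` ignore the clock and are therefore censored at any threshold. This lets the
clock martingale be treated uniformly in time. -/
lemma censored_of_measurableSet_clockFiltration {k : ℝ≥0} {A : Set (Ω × ℝ)}
    (hA : MeasurableSet[clockFiltration ℱ T p hp k] A) : MeasurableSet[censored (p k)] A := by
  rcases le_or_gt k T with hk | hk
  · rw [clockFiltration_of_le hk] at hA
    obtain ⟨B, hB, rfl⟩ := hA
    exact ⟨measurable_fst (ℱ.le k _ hB), fun _ _ _ _ _ => Iff.rfl⟩
  · rwa [clockFiltration_of_lt hk] at hA

variable {P : Measure Ω} [IsProbabilityMeasure P] {ν : Measure ℝ} [IsProbabilityMeasure ν]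

/-- A martingale that is constant after time `T` remains a martingale when the clock is added. -/
lemma martingale_comp_fst_clockFiltration {Z : ℝ≥0 → Ω → ℝ} (hZ : Martingale Z ℱ P)
    (hconst : ∀ k, T ≤ k → Z k = Z T) :
    Martingale (fun k (w : Ω × ℝ) => Z k w.1) (clockFiltration ℱ T p hp) (P.prod ν) := by
  refine martingale_of_forall_setIntegral_eq
    (fun k => (hZ.1 k).comp_measurable (measurable_fst_clockFiltration k))
    (fun k => (hZ.integrable k).comp_fst ν) fun i j hij A hA => ?_
  rcases le_or_gt i T with hi | hi
  · rw [clockFiltration_of_le hi] at hA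
    obtain ⟨B, hB, rfl⟩ := hA
    have key : ∀ k, ∫ w in Prod.fst ⁻¹' B, Z k w.1 ∂(P.prod ν) = ∫ ω in B, Z k ω ∂P := by
      intro k
      have hmap : (P.prod ν).map Prod.fst = P := by
        rw [Measure.map_fst_prod, measure_univ, one_smul]
      have := setIntegral_map (μ := P.prod ν) (g := Prod.fst) (f := Z k) (ℱ.le i _ hB)
        (by rw [hmap]; exact (hZ.integrable k).aestronglyMeasurable) measurable_fst.aemeasurable
      rw [hmap] at this
      exact this.symm
    rw [key, key]
    exact hZ.setIntegral_eq hij hB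
  · rw [hconst i hi.le, hconst j (hi.le.trans hij)]

/-- The compensated jump of the clock is a martingale. -/
lemma martingale_compensatedJump (hν : ∀ p, 0 ≤ p → ∫ e, compensatedJump p e ∂ν = 0)
    (hpm : ∀ k, Measurable (p k)) (hp0 : ∀ k ω, k ≤ T → p k ω = 0) {B : ℝ}
    (hpB : ∀ k ω, p k ω ≤ B) :
    Martingale (fun k (w : Ω × ℝ) => compensatedJump (p k w.1) w.2)
      (clockFiltration ℱ T p hp) (P.prod ν) := by
  have hpos : ∀ k ω, 0 ≤ p k ω := fun k ω => (hp0 0 ω zero_le).symm.le.trans (hp ω zero_le)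
  have hm : ∀ k, Measurable fun w : Ω × ℝ => compensatedJump (p k w.1) w.2 := fun k =>
    measurable_compensatedJump ((hpm k).comp measurable_fst) measurable_snd
  have hint : ∀ k, Integrable (fun w : Ω × ℝ => compensatedJump (p k w.1) w.2) (P.prod ν) :=
    fun k => Integrable.of_bound (C := 1 + B) (hm k).aestronglyMeasurable
      (Filter.Eventually.of_forall fun w =>
        (abs_compensatedJump_le (hpos _ _) _).trans (by linarith [hpB k w.1]))
  refine martingale_of_forall_setIntegral_eq (fun k => ?_) hint fun i j hij A hA => ?_
  · refine Measurable.stronglyMeasurable ?_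
    rcases le_or_gt k T with hk | hk
    · have e : (fun w : Ω × ℝ => compensatedJump (p k w.1) w.2) = fun _ => 0 := by
        ext w
        rw [hp0 k _ hk, compensatedJump, min_eq_right (le_max_right _ _), if_neg (by
          rintro ⟨h1, h2⟩; linarith), sub_zero]
      rw [e]; exact measurable_const
    · rw [clockFiltration_of_lt hk]
      refine measurable_censored (hm k) fun ω e e' he he' => ?_
      simp only [compensatedJump, he.not_ge, he'.not_ge, and_false, if_false,
        min_eq_right (he.le.trans (le_max_left _ _)), min_eq_right (he'.le.trans (le_max_left _ _))]
  · have hA' := censored_of_measurableSet_clockFiltration hA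
    have hzero : ∫ w in A, (compensatedJump (p j w.1) w.2 - compensatedJump (p i w.1) w.2)
        ∂(P.prod ν) = 0 := by
      have hd := (hint j).sub (hint i)
      simp only [Pi.sub_def] at hd
      rw [← integral_indicator hA'.1, integral_prod _ (hd.indicator hA'.1)]
      refine integral_eq_zero_of_ae (Filter.Eventually.of_forall fun ω => ?_)
      -- The increment vanishes for `y` up to the threshold `p i ω`, and above it membership in `A`
      -- does not depend on `y`. The indicator may thus be evaluated at any point above the
      -- threshold, here `p i ω + 1`, and leaves the inner integral.
      have e : ∀ y, A.indicator
          (fun w : Ω × ℝ => compensatedJump (p j w.1) w.2 - compensatedJump (p i w.1) w.2) (ω, y)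
          = A.indicator (fun _ => (1 : ℝ)) (ω, p i ω + 1)
            * (compensatedJump (p j ω) y - compensatedJump (p i ω) y) := by
        intro y
        rcases le_or_gt y (p i ω) with hy | hy
        · have h0 : compensatedJump (p j ω) y - compensatedJump (p i ω) y = 0 :=
            sub_eq_zero.2 (compensatedJump_eq_of_le (hpos _ _) (hp ω hij) hy)
          rw [h0, mul_zero, indicator_apply_eq_zero]
          exact fun _ => h0
        · have := hA'.2 ω y (p i ω + 1) hy (by linarith)
          by_cases hmem : (ω, y) ∈ A
          · rw [indicator_of_mem hmem, indicator_of_mem (this.1 hmem), one_mul]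
          · rw [indicator_of_notMem hmem, indicator_of_notMem (fun h => hmem (this.2 h)), zero_mul]
      have hi : ∀ k, Integrable (fun y => compensatedJump (p k ω) y) ν := fun k =>
        Integrable.of_bound (C := 1 + p k ω)
          (measurable_compensatedJump measurable_const measurable_id).aestronglyMeasurable
          (Filter.Eventually.of_forall fun y => abs_compensatedJump_le (hpos _ _) _)
      simp only [e, Pi.zero_apply]
      rw [integral_const_mul, integral_sub (hi j) (hi i), hν _ (hpos _ _), hν _ (hpos _ _),
        sub_zero, mul_zero]
    rw [integral_sub (hint j).integrableOn (hint i).integrableOn] at hzero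
    linarith

/-- A process that follows a predictable process up to time `T`, and then an observed value until
the clock rings or time runs out, is predictable. -/
lemma isStronglyPredictable_clock {s : ℝ≥0 → Ω → ℝ} (hs : IsStronglyPredictable ℱ s)
    {g : Ω → ℝ} (hg : Measurable[ℱ T] g) (hpm : ∀ k, Measurable (p k))
    (hpc : ∀ ω, Continuous fun k => p k ω) (T' : ℝ≥0) :
    IsStronglyPredictable (clockFiltration ℱ T p hp) fun k (w : Ω × ℝ) =>
      if k ≤ T then s k w.1 else if k ≤ T' ∧ p k w.1 ≤ w.2 then g w.1 else 0 := by
  set 𝒢 := clockFiltration ℱ T p hp with h𝒢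
  let _ : MeasurableSpace (ℝ≥0 × (Ω × ℝ)) := 𝒢.predictable
  have hIoi : ∀ i : ℝ≥0, MeasurableSet[𝒢.predictable] {w : ℝ≥0 × (Ω × ℝ) | i < w.1} := by
    intro i
    have := measurableSet_predictable_Ioi_prod (𝓕 := 𝒢) (i := i) (s := univ) MeasurableSet.univ
    convert this using 1
    ext w; simp
  have hs' : Measurable[𝒢.predictable] fun w : ℝ≥0 × (Ω × ℝ) => s w.1 w.2.1 := by
    have hmap : @Measurable _ _ 𝒢.predictable ℱ.predictable
        fun w : ℝ≥0 × (Ω × ℝ) => ((w.1, w.2.1) : ℝ≥0 × Ω) := by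
      refine @measurable_generateFrom _ _ 𝒢.predictable _ _ ?_
      rintro _ (⟨A, hA, rfl⟩ | ⟨i, A, hA, rfl⟩)
      · exact measurableSet_predictable_singleton_bot_prod
          (measurable_fst_clockFiltration (p := p) (hp := hp) (T := T) ⊥ hA)
      · exact measurableSet_predictable_Ioi_prod
          (measurable_fst_clockFiltration (p := p) (hp := hp) (T := T) i hA)
    exact (StronglyMeasurable.measurable hs).comp hmap
  have hg' : Measurable[𝒢.predictable] fun w : ℝ≥0 × (Ω × ℝ) =>
      if T < w.1 then g w.2.1 else 0 := by
    intro B hB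
    have h1 : MeasurableSet[𝒢.predictable]
        (Ioi T ×ˢ ((Prod.fst : Ω × ℝ → Ω) ⁻¹' (g ⁻¹' B)) : Set (ℝ≥0 × (Ω × ℝ))) :=
      measurableSet_predictable_Ioi_prod (measurable_fst_clockFiltration T (hg hB))
    by_cases h0 : (0 : ℝ) ∈ B
    · convert h1.union (hIoi T).compl using 1
      ext w
      by_cases hw : T < w.1 <;> simp [hw, h0]
    · convert h1 using 1
      ext w
      by_cases hw : T < w.1 <;> simp [hw, h0]
  -- By continuity of `p`, a clock that has been passed strictly at `k` was already passed at some
  -- earlier time `q > T` of a countable dense set, when the event was observable.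
  have hring : MeasurableSet[𝒢.predictable]
      {w : ℝ≥0 × (Ω × ℝ) | T < w.1 ∧ w.2.2 < p w.1 w.2.1} := by
    obtain ⟨D, hD, hDd⟩ := TopologicalSpace.exists_countable_dense ℝ≥0
    have e : {w : ℝ≥0 × (Ω × ℝ) | T < w.1 ∧ w.2.2 < p w.1 w.2.1} =
        ⋃ q ∈ D ∩ Ioi T, Ioi q ×ˢ {w : Ω × ℝ | w.2 < p q w.1} := by
      ext ⟨k, ω, y⟩
      simp only [mem_ofPred_eq, mem_iUnion, mem_prod, exists_prop, mem_inter_iff, mem_Ioi]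
      constructor
      · rintro ⟨hk, hy⟩
        have hnhds : {j | y < p j ω} ∈ nhds k :=
          (isOpen_Ioi.preimage (hpc ω)).mem_nhds hy
        obtain ⟨l, hl, hsub⟩ := exists_Ioc_subset_of_mem_nhds hnhds ⟨T, hk⟩
        obtain ⟨q, hq, hq1, hq2⟩ := hDd.exists_between (max_lt hl hk)
        exact ⟨q, ⟨hq, (le_max_right _ _).trans_lt hq1⟩, hq2,
          hsub ⟨(le_max_left _ _).trans_lt hq1, hq2.le⟩⟩
      · rintro ⟨q, ⟨_, hTq⟩, hqk, hy⟩
        exact ⟨hTq.trans hqk, hy.trans_le (hp ω hqk.le)⟩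
    rw [e]
    refine MeasurableSet.biUnion (hD.mono inter_subset_left) fun q hq => ?_
    refine measurableSet_predictable_Ioi_prod ?_
    rw [h𝒢, clockFiltration_of_lt hq.2]
    exact ⟨measurableSet_lt measurable_snd ((hpm q).comp measurable_fst),
      fun ω y y' hy hy' => iff_of_false hy.not_gt hy'.not_gt⟩
  refine Measurable.stronglyMeasurable ?_
  have e : (Function.uncurry fun (k : ℝ≥0) (w : Ω × ℝ) =>
      if k ≤ T then s k w.1 else if k ≤ T' ∧ p k w.1 ≤ w.2 then g w.1 else 0) =
      fun w : ℝ≥0 × (Ω × ℝ) => if T < w.1 then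
        (if (T < w.1 ∧ w.2.2 < p w.1 w.2.1) ∨ T' < w.1 then 0
          else if T < w.1 then g w.2.1 else 0) else s w.1 w.2.1 := by
    ext ⟨k, ω, y⟩
    simp only [Function.uncurry_apply_pair]
    by_cases hk : k ≤ T
    · rw [if_pos hk, if_neg hk.not_gt]
    · have hk' : T < k := not_le.1 hk
      rw [if_neg hk, if_pos hk']
      by_cases h : k ≤ T' ∧ p k ω ≤ y
      · rw [if_pos h, if_neg, if_pos hk']
        rintro (h1 | h1)
        · exact h.2.not_gt h1.2
        · exact h.1.not_gt h1
      · rw [if_neg h, if_pos]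
        rw [not_and_or, not_le, not_le] at h
        exact h.symm.imp_left fun h => ⟨hk', h⟩
  rw [e]
  exact Measurable.ite (hIoi T) (Measurable.ite (hring.union (hIoi T')) measurable_const hg') hs'

end ClockFiltration

end SingleJump

/-! ### Operational time on one interval of the grid -/

section Elapsed

/-- The part of the interval from `T` to `T + h` that has elapsed at time `k`. -/
def elapsed (T h k : ℝ≥0) : ℝ≥0 := min k (T + h) - T

variable (T h : ℝ≥0)

lemma elapsed_of_le {k : ℝ≥0} (hk : k ≤ T) : elapsed T h k = 0 :=
  tsub_eq_zero_of_le ((min_le_left _ _).trans hk)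

lemma monotone_elapsed : Monotone (elapsed T h) := fun _ _ hjk =>
  tsub_le_tsub_right (min_le_min_right _ hjk) _

lemma continuous_elapsed : Continuous (elapsed T h) :=
  (continuous_id.min continuous_const).sub continuous_const

lemma elapsed_le (k : ℝ≥0) : elapsed T h k ≤ h := by
  unfold elapsed
  rw [tsub_le_iff_left]
  exact min_le_right _ _

lemma elapsed_of_ge {k : ℝ≥0} (hk : T + h ≤ k) : elapsed T h k = h := by
  rw [elapsed, min_eq_right hk, add_tsub_cancel_left]

lemma elapsed_lt_elapsed {j k : ℝ≥0} (hjk : j < k) (hk : T < k) (hk' : k ≤ T + h) :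
    elapsed T h j < elapsed T h k := by
  unfold elapsed
  rw [min_eq_left hk', min_eq_left (hjk.le.trans hk')]
  rcases le_total j T with hj | hj
  · rw [tsub_eq_zero_of_le hj]
    exact tsub_pos_of_lt hk
  · exact tsub_lt_tsub_right_of_le hj hjk

end Elapsed

lemma coe_elapsed (T h k : ℝ≥0) :
    (elapsed T h k : ℝ) = max (min (k : ℝ) (T + h) - T) 0 := by
  rw [elapsed, NNReal.coe_sub_def, NNReal.coe_min, NNReal.coe_add]

/-- The accumulated intensity up to the ringing of the clock. -/
lemma integral_ite_intensity {α : ℝ} (hα : 0 ≤ α) (T h k : ℝ≥0) (e : ℝ) :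
    ∫ j in (0 : ℝ)..k, (if T < j.toNNReal ∧ j.toNNReal ≤ T + h ∧
        α * elapsed T h j.toNNReal ≤ e then α else 0) = min (max e 0) (α * elapsed T h k) := by
  rcases hα.eq_or_lt with rfl | hα
  · simp
  -- The clock rings at time `T + e / α`, so up to time `k` the intensity is `α` on one interval and
  -- zero elsewhere; dividing by `α` is why `α = 0` was split off.
  have hset : ∀ j ∈ Ioc (0 : ℝ) k, (if T < j.toNNReal ∧ j.toNNReal ≤ T + h ∧
        α * elapsed T h j.toNNReal ≤ e then α else 0)
      = (Ioc (T : ℝ) (min (min k (T + h)) (T + e / α))).indicator (fun _ => α) j := by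
    intro j hj
    have hj0 : (0 : ℝ) ≤ j := hj.1.le
    have hj' : ((j.toNNReal : ℝ≥0) : ℝ) = j := Real.coe_toNNReal _ hj0
    rw [indicator_apply]
    refine if_congr ?_ rfl rfl
    rw [coe_elapsed, hj', ← NNReal.coe_lt_coe, ← NNReal.coe_le_coe, hj', NNReal.coe_add, mem_Ioc,
      le_min_iff, le_min_iff]
    constructor
    · rintro ⟨h1, h2, h3⟩
      rw [min_eq_left h2, max_eq_left (by linarith), mul_comm, ← le_div_iff₀ hα] at h3
      exact ⟨h1, ⟨hj.2, h2⟩, by linarith⟩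
    · rintro ⟨h1, ⟨_, h2⟩, h3⟩
      refine ⟨h1, h2, ?_⟩
      rw [min_eq_left h2, max_eq_left (by linarith), mul_comm, ← le_div_iff₀ hα]
      linarith
  rw [intervalIntegral.integral_of_le k.coe_nonneg, setIntegral_congr_fun measurableSet_Ioc hset,
    setIntegral_indicator measurableSet_Ioc, inter_eq_right.2 (Ioc_subset_Ioc T.coe_nonneg
      ((min_le_left _ _).trans (min_le_left _ _))), setIntegral_const, smul_eq_mul,
    Real.volume_real_Ioc, coe_elapsed]
  have h1 : max e 0 = α * max (e / α) 0 := by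
    rw [mul_max_of_nonneg _ _ hα.le, mul_zero, mul_div_cancel₀ e hα.ne']
  rw [h1, ← mul_min_of_nonneg _ _ hα.le, mul_comm, ← max_min_distrib_right, min_comm (e / α),
    ← min_sub_sub_right _ _ (T : ℝ), add_sub_cancel_left]

/-! ### Extending a policy by one interval -/

namespace ProductionModel

variable {M : ProductionModel} {x : ℕ} {Ω : Type} [mΩ : MeasurableSpace Ω] {P : Measure Ω}
 {ℱ : Filtration ℝ≥0 mΩ} {X : ℝ≥0 → Ω → ℕ} {s : ℝ≥0 → Ω → ℝ}

lemma IsAdmissible.intervalIntegrable_intensity (hadm : M.IsAdmissible x P ℱ X s) (ω : Ω)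
    (b c : ℝ) : IntervalIntegrable (fun j : ℝ => M.lam * M.f (s j.toNNReal ω)) volume b c :=
  intervalIntegrable_of_abs_le (g := fun j : ℝ => M.lam * M.f (s j.toNNReal ω))
    (hadm.measurable_uncurry_intensity.comp (measurable_id.prodMk measurable_const))
    (C := M.maxIntensity) (fun j => by
      rw [abs_of_nonneg (M.intensity_nonneg (hadm.rate_mem _ _))]
      exact M.intensity_le (hadm.rate_mem _ _)) b c

/-- A policy that is turned off after time `T` can be continued by producing at a rate `a y` that
depends on the level `y` at time `T`, until the next jump or until time `T + h`. -/
theorem IsAdmissible.extend [IsProbabilityMeasure P] (hadm : M.IsAdmissible x P ℱ X s) {T : ℝ≥0}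
    (hoff : ∀ ω k, T < k → s k ω = 0) (hconst : ∀ ω k, T ≤ k → X k ω = X T ω) (h : ℝ≥0)
    {a : ℕ → ℝ} (ha : ∀ y, a y ∈ M.rates) (haξ : a M.ξ = 0) {ν : Measure ℝ}
    [IsProbabilityMeasure ν] (hν : ∀ p, 0 ≤ p → ∫ e, compensatedJump p e ∂ν = 0) :
    ∃ ℱ' : Filtration ℝ≥0 (inferInstance : MeasurableSpace (Ω × ℝ)),
      M.IsAdmissible x (P.prod ν) ℱ'
        (fun k w => X k w.1 + if 0 < w.2 ∧ w.2 ≤ M.lam * M.f (a (X T w.1)) * elapsed T h k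
          then 1 else 0)
        (fun k w => if k ≤ T then s k w.1 else
          if k ≤ T + h ∧ M.lam * M.f (a (X T w.1)) * elapsed T h k ≤ w.2
          then a (X T w.1) else 0) := by
  set α : Ω → ℝ := fun ω => M.lam * M.f (a (X T ω)) with hα
  set p : ℝ≥0 → Ω → ℝ := fun k ω => α ω * elapsed T h k with hpdef
  have hα0 : ∀ ω, 0 ≤ α ω := fun ω => M.intensity_nonneg (ha _)
  have hp : ∀ ω, Monotone fun k => p k ω := fun ω j k hjk =>
    mul_le_mul_of_nonneg_left (NNReal.coe_le_coe.2 (monotone_elapsed T h hjk)) (hα0 ω)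
  have hp0 : ∀ k ω, k ≤ T → p k ω = 0 := fun k ω hk => by
    simp [hpdef, elapsed_of_le T h hk]
  have hpc : ∀ ω, Continuous fun k => p k ω := fun ω =>
    continuous_const.mul (NNReal.continuous_coe.comp (continuous_elapsed T h))
  have hpm : ∀ k, Measurable (p k) := fun k =>
    ((measurable_of_countable fun y => M.lam * M.f (a y)).comp
      (hadm.measurable_level T)).mul_const _
  have hpB : ∀ k ω, p k ω ≤ M.maxIntensity * h := fun k ω =>
    mul_le_mul (M.intensity_le (ha _)) (NNReal.coe_le_coe.2 (elapsed_le T h k)) NNReal.zero_le_coe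
      NNReal.zero_le_coe
  have hαξ : ∀ ω, X T ω = M.ξ → α ω = 0 := fun ω hω => by
    simp only [hα, hω, haξ, M.f_zero, mul_zero]
  -- The accumulated intensity splits into the old one, which stops growing at `T`, and exactly the
  -- compensator in `compensatedJump`. The new compensated level is then a sum of two martingales.
  have hcomp : ∀ (k : ℝ≥0) (w : Ω × ℝ), ∫ j in (0 : ℝ)..(k : ℝ), M.lam * M.f
      (if j.toNNReal ≤ T then s j.toNNReal w.1 else
        if j.toNNReal ≤ T + h ∧ p j.toNNReal w.1 ≤ w.2 then a (X T w.1) else 0)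
      = (∫ j in (0 : ℝ)..(k : ℝ), M.lam * M.f (s j.toNNReal w.1))
        + min (max w.2 0) (p k w.1) := by
    intro k w
    have hi1 : IntervalIntegrable (fun j : ℝ => M.lam * M.f (s j.toNNReal w.1)) volume 0 k :=
      hadm.intervalIntegrable_intensity _ _ _
    have hi2 : IntervalIntegrable (fun j : ℝ => if T < j.toNNReal ∧ j.toNNReal ≤ T + h ∧
        α w.1 * elapsed T h j.toNNReal ≤ w.2 then α w.1 else 0) volume 0 k := by
      refine intervalIntegrable_of_abs_le (Measurable.ite ?_ measurable_const measurable_const)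
        (C := α w.1) (fun j => ?_) 0 k
      · exact (measurableSet_lt measurable_const measurable_real_toNNReal).inter
          ((measurableSet_le measurable_real_toNNReal measurable_const).inter
          (measurableSet_le ((hpc w.1).measurable.comp measurable_real_toNNReal)
            measurable_const))
      · split_ifs
        · rw [abs_of_nonneg (hα0 _)]
        · rw [abs_zero]; exact hα0 _
    rw [← integral_ite_intensity (hα0 w.1), ← intervalIntegral.integral_add hi1 hi2]
    refine intervalIntegral.integral_congr fun j _ => ?_
    by_cases hj : j.toNNReal ≤ T
    · rw [if_pos hj, if_neg (fun h => hj.not_gt h.1), add_zero]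
    · have hj' := not_le.1 hj
      rw [if_neg hj, hoff _ _ hj', M.f_zero, mul_zero, zero_add]
      by_cases h2 : j.toNNReal ≤ T + h ∧ p j.toNNReal w.1 ≤ w.2
      · rw [if_pos h2, if_pos ⟨hj', h2⟩]
      · rw [if_neg h2, if_neg (fun h => h2 h.2), M.f_zero, mul_zero]
  have hle : ∀ᵐ w ∂(P.prod ν), ∀ k, X k w.1 ≤ M.ξ :=
    Measure.quasiMeasurePreserving_fst.ae hadm.level_le
  have hoff' : ∀ᵐ w ∂(P.prod ν), ∀ j k, j < k → X j w.1 = M.ξ → s k w.1 = 0 :=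
    Measure.quasiMeasurePreserving_fst.ae hadm.off_after_failure
  refine ⟨clockFiltration ℱ T p hp, ?_, ?_, ?_, ?_, ?_, ?_, ?_, ?_, ?_, ?_⟩
  · intro k w
    split_ifs
    exacts [hadm.rate_mem _ _, ha _, M.zero_mem_rates]
  · exact isStronglyPredictable_clock hadm.predictable
      ((measurable_of_countable a).comp (hadm.adapted T)) hpm hpc (T + h)
  · intro k
    refine Measurable.add ((hadm.adapted k).comp (measurable_fst_clockFiltration k)) ?_
    rcases le_or_gt k T with hk | hk
    · have e : (fun w : Ω × ℝ => if 0 < w.2 ∧ w.2 ≤ α w.1 * elapsed T h k then 1 else 0)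
          = fun _ => 0 := by
        ext w
        rw [if_neg]
        rintro ⟨h1, h2⟩
        exact absurd (h1.trans_le h2) (hp0 k w.1 hk).not_gt
      rw [e]; exact measurable_const
    · rw [clockFiltration_of_lt hk]
      refine measurable_censored (Measurable.ite ((measurableSet_lt measurable_const
        measurable_snd).inter (measurableSet_le measurable_snd ((hpm k).comp measurable_fst)))
        measurable_const measurable_const) fun ω e e' he he' => ?_
      rw [if_neg (fun h => he.not_ge h.2), if_neg (fun h => he'.not_ge h.2)]
  · intro w
    rw [hadm.start, if_neg, add_zero]
    rintro ⟨h1, h2⟩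
    exact absurd (h1.trans_le h2) (hp0 0 w.1 zero_le).not_gt
  · intro w j k hjk
    refine add_le_add (hadm.monotone w.1 hjk) ?_
    by_cases hj : 0 < w.2 ∧ w.2 ≤ α w.1 * elapsed T h j
    · rw [if_pos hj, if_pos ⟨hj.1, hj.2.trans (hp w.1 hjk)⟩]
    · rw [if_neg hj]; exact Nat.zero_le _
  · intro w k
    refine ContinuousWithinAt.add (hadm.right_continuous w.1 k) ?_
    by_cases hk : 0 < w.2 ∧ w.2 ≤ α w.1 * elapsed T h k
    · refine (continuousWithinAt_const (b := 1)).congr (fun j hj => ?_) (if_pos hk)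
      exact if_pos ⟨hk.1, hk.2.trans (hp w.1 hj)⟩
    · refine ContinuousAt.continuousWithinAt ?_
      by_cases he : 0 < w.2
      · have hlt : p k w.1 < w.2 := not_le.1 fun h => hk ⟨he, h⟩
        have hev : (fun _ => 0) =ᶠ[nhds k] fun j : ℝ≥0 =>
            if 0 < w.2 ∧ w.2 ≤ α w.1 * elapsed T h j then 1 else 0 := by
          filter_upwards [(isOpen_Iio.preimage (hpc w.1)).mem_nhds hlt] with j hj
          exact (if_neg fun h => (show p j w.1 < w.2 from hj).not_ge h.2).symm
        exact continuousAt_const.congr hev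
      · simp only [he, false_and, if_false]
        exact continuousAt_const
  · intro w k hk
    rcases le_or_gt k T with hkT | hkT
    · obtain ⟨j, hj, hjump⟩ := hadm.unit_jumps w.1 k hk
      refine ⟨j, hj, ?_⟩
      rw [if_neg, if_neg]
      · exact hjump
      · rintro ⟨h1, h2⟩
        exact absurd (h1.trans_le h2) (hp0 j w.1 (hj.le.trans hkT)).not_gt
      · rintro ⟨h1, h2⟩
        exact absurd (h1.trans_le h2) (hp0 k w.1 hkT).not_gt
    -- After `T` only the clock can raise the level, and it does so once.
    · refine ⟨T, hkT, ?_⟩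
      rw [hconst _ _ hkT.le]
      split_ifs <;> omega
  · have hZ : ∀ k, T ≤ k →
        (fun ω => (X k ω : ℝ) - ∫ j in (0 : ℝ)..(k : ℝ), M.lam * M.f (s j.toNNReal ω))
        = fun ω => (X T ω : ℝ) - ∫ j in (0 : ℝ)..(T : ℝ), M.lam * M.f (s j.toNNReal ω) := by
      intro k hk
      ext ω
      have hi : ∀ b c : ℝ, IntervalIntegrable
          (fun j : ℝ => M.lam * M.f (s j.toNNReal ω)) volume b c :=
        hadm.intervalIntegrable_intensity ω
      have h0 : ∫ j in (T : ℝ)..(k : ℝ), M.lam * M.f (s j.toNNReal ω) = 0 := by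
        refine intervalIntegral.integral_zero_ae (Filter.Eventually.of_forall fun j hj => ?_)
        rw [uIoc_of_le (NNReal.coe_le_coe.2 hk)] at hj
        rw [hoff ω _ (Real.lt_toNNReal_iff_coe_lt.2 hj.1), M.f_zero, mul_zero]
      rw [hconst ω k hk, ← intervalIntegral.integral_add_adjacent_intervals (hi 0 T) (hi T k), h0,
        add_zero]
    have h1 := martingale_comp_fst_clockFiltration (T := T) (p := p) (hp := hp) (ν := ν)
      hadm.intensity hZ
    have h2 := martingale_compensatedJump (ℱ := ℱ) (T := T) (hp := hp) (P := P) hν hpm hp0 hpB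
    convert! h1.add h2 using 1
    ext k w
    rw [hcomp]
    simp only [Pi.add_apply, compensatedJump, hpdef]
    push_cast
    ring
  · filter_upwards [hle] with w hw k
    rcases le_or_gt k T with hkT | hkT
    · rw [if_neg, add_zero]
      · exact hw k
      · rintro ⟨h1, h2⟩
        exact absurd (h1.trans_le h2) (hp0 k w.1 hkT).not_gt
    · rw [hconst _ _ hkT.le]
      rcases (hw T).eq_or_lt with heq | hlt
      · rw [if_neg, heq, add_zero]
        rintro ⟨h1, h2⟩
        rw [show M.lam * M.f (a (X T w.1)) = 0 from hαξ _ heq, zero_mul] at h2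
        exact h2.not_gt h1
      · split_ifs <;> omega
  · filter_upwards [hle, hoff'] with w hw hwoff j k hjk hj
    rcases le_or_gt k T with hkT | hkT
    · rw [if_pos hkT]
      rw [if_neg, add_zero] at hj
      · exact hwoff j k hjk hj
      · rintro ⟨h1, h2⟩
        exact absurd (h1.trans_le h2) (hp0 j w.1 (hjk.le.trans hkT)).not_gt
    · rw [if_neg hkT.not_ge]
      rcases (hw T).eq_or_lt with heq | hlt
      · rw [heq, haξ, ite_self]
      · rw [if_neg]
        rintro ⟨h1, h2⟩
        have hXj : X j w.1 < M.ξ := by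
          rcases le_total j T with hjT | hjT
          · exact (hadm.monotone w.1 hjT).trans_lt hlt
          · rwa [hconst _ _ hjT]
        -- Failure at `j` from a functioning level at `T` means that the clock has rung by `j`.
        -- Operational time increases strictly between `j` and `k`, so it exceeds the clock value at
        -- `k`, where a rate still switched on would need the reverse.
        have hjp : 0 < w.2 ∧ w.2 ≤ α w.1 * elapsed T h j := by
          by_contra hcon
          rw [if_neg hcon, add_zero] at hj
          exact hXj.ne hj
        have hαpos : 0 < α w.1 := by
          rcases (hα0 w.1).eq_or_lt with h0 | h0
          · rw [← h0, zero_mul] at hjp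
            exact absurd hjp.1 hjp.2.not_gt
          · exact h0
        have := mul_lt_mul_of_pos_left
          (NNReal.coe_lt_coe.2 (elapsed_lt_elapsed T h hjk hkT h1)) hαpos
        linarith [hjp.2]

end ProductionModel

/-! ### Near-optimal policies -/

namespace ProductionModel

variable (M : ProductionModel)

/-- A system that is never turned on stays at its level. -/
lemma isAdmissible_idle {x : ℕ} (hx : x ≤ M.ξ) :
    M.IsAdmissible x (Measure.dirac ()) (⊥ : Filtration ℝ≥0 _) (fun _ _ => x) (fun _ _ => 0) where
  rate_mem _ _ := M.zero_mem_rates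
  predictable := stronglyMeasurable_const
  adapted _ := measurable_const
  start _ := rfl
  monotone _ := monotone_const
  right_continuous _ _ := continuousWithinAt_const
  unit_jumps _ k hk := ⟨0, hk, Nat.le_succ _⟩
  intensity := by
    simp only [M.f_zero, mul_zero, intervalIntegral.integral_zero, sub_zero]
    exact martingale_const _ _ _
  level_le := Filter.Eventually.of_forall fun _ _ => hx
  off_after_failure := Filter.Eventually.of_forall fun _ _ _ _ _ => rfl

/-- If on every interval of a grid of width `h` some rate satisfies `Q` throughout the interval,
then there is a policy that satisfies `Q` except on a set of times of which the size is at most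
`h` for every unit of deterioration. -/
theorem exists_isAdmissible_forall_notMem {Q : ℝ≥0 → ℕ → ℝ → Prop} {x : ℕ} (hx : x ≤ M.ξ)
    (h : ℝ≥0) (n : ℕ)
    (hQ : ∀ i < n, ∀ y ≤ M.ξ, ∃ a ∈ M.rates, (y = M.ξ → a = 0) ∧
      ∀ k : ℝ≥0, i * h < k → k ≤ (i + 1 : ℕ) * h → Q k y a) :
    ∃ (Ω : Type) (mΩ : MeasurableSpace Ω) (P : Measure Ω) (_ : IsProbabilityMeasure P)
      (ℱ : Filtration ℝ≥0 mΩ) (X : ℝ≥0 → Ω → ℕ) (s : ℝ≥0 → Ω → ℝ),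
      M.IsAdmissible x P ℱ X s ∧ (∀ ω k, n * h < k → s k ω = 0) ∧
      (∀ ω k, n * h ≤ k → X k ω = X (n * h) ω) ∧
      ∀ᵐ ω ∂P, ∃ U : Set ℝ, MeasurableSet U ∧ volume U ≤ X (n * h) ω * (h : ENNReal) ∧
        ∀ k : ℝ≥0, 0 < k → k ≤ n * h → (k : ℝ) ∉ U → Q k (X k ω) (s k ω) := by
  induction n with
  | zero =>
    refine ⟨Unit, _, Measure.dirac (), inferInstance, ⊥, _, _, M.isAdmissible_idle hx,
      fun _ _ _ => rfl, fun _ _ _ => rfl, Filter.Eventually.of_forall fun ω =>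
        ⟨∅, MeasurableSet.empty, by simp, fun k hk hk' _ => ?_⟩⟩
    rw [Nat.cast_zero, zero_mul] at hk'
    exact absurd hk hk'.not_gt
  | succ n ih =>
    obtain ⟨Ω, mΩ, P, hP, ℱ, X, s, hadm, hoff, hconst, hU⟩ :=
      ih fun i hi => hQ i (hi.trans (Nat.lt_succ_self n))
    have hsel : ∀ y, ∃ a ∈ M.rates, (y = M.ξ → a = 0) ∧ (y ≤ M.ξ →
        ∀ k : ℝ≥0, n * h < k → k ≤ (n + 1 : ℕ) * h → Q k y a) := by
      intro y
      by_cases hy : y ≤ M.ξ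
      · obtain ⟨a, ha, ha0, haQ⟩ := hQ n (Nat.lt_succ_self n) y hy
        exact ⟨a, ha, ha0, fun _ => haQ⟩
      · exact ⟨0, M.zero_mem_rates, fun _ => rfl, fun h => absurd h hy⟩
    choose a ha ha0 haQ using hsel
    obtain ⟨ν, hν, hνpos, hν0⟩ := exists_unit_exponential
    obtain ⟨ℱ', hadm'⟩ := hadm.extend hoff hconst h ha (ha0 _ rfl) hν0
    have hT : ((n + 1 : ℕ) : ℝ≥0) * h = n * h + h := by push_cast; ring
    have hTle : (n : ℝ≥0) * h ≤ (n + 1 : ℕ) * h := by rw [hT]; exact le_self_add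
    rw [hT] at haQ ⊢
    rw [hT] at hTle
    refine ⟨Ω × ℝ, _, P.prod ν, inferInstance, ℱ', _, _, hadm', fun w k hk => ?_,
      fun w k hk => ?_, ?_⟩
    · rw [if_neg (hTle.trans_lt hk).not_ge, if_neg fun h => h.1.not_gt hk]
    · rw [elapsed_of_ge _ _ hk, elapsed_of_ge _ _ le_rfl, hconst _ _ (hTle.trans hk),
        hconst _ _ hTle]
    · filter_upwards [Measure.quasiMeasurePreserving_fst.ae hU,
        Measure.quasiMeasurePreserving_fst.ae hadm.level_le,
        Measure.quasiMeasurePreserving_snd.ae hνpos] with w hUw hle hpos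
      obtain ⟨U, hUm, hUv, hUQ⟩ := hUw
      have hα : 0 ≤ M.lam * M.f (a (X (n * h) w.1)) := M.intensity_nonneg (ha _)
      have hnojump : ∀ k ≤ n * h,
          ¬ (0 < w.2 ∧ w.2 ≤ M.lam * M.f (a (X (n * h) w.1)) * elapsed (n * h) h k) := by
        rintro k hk ⟨h1, h2⟩
        rw [elapsed_of_le _ _ hk, NNReal.coe_zero, mul_zero] at h2
        exact h2.not_gt h1
      rw [hconst _ _ hTle, elapsed_of_ge _ _ le_rfl]
      -- If the clock rings within the interval, the whole interval is written off: its length `h`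
      -- is paid for by the unit gained by the level. Otherwise the level and the chosen rate
      -- persist throughout.
      by_cases hring : w.2 ≤ M.lam * M.f (a (X (n * h) w.1)) * h
      · refine ⟨U ∪ Ioc ((n * h : ℝ≥0) : ℝ) ((n * h + h : ℝ≥0) : ℝ), hUm.union measurableSet_Ioc,
          ?_, fun k hk0 hk hkU => ?_⟩
        · refine (measure_union_le _ _).trans ?_
          rw [if_pos ⟨hpos, hring⟩, Real.volume_Ioc, NNReal.coe_add, add_sub_cancel_left,
            ENNReal.ofReal_coe_nnreal]
          push_cast
          rw [add_mul, one_mul]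
          exact add_le_add hUv le_rfl
        · rw [mem_union, not_or] at hkU
          have hkT : k ≤ n * h := by
            by_contra hcon
            exact hkU.2 ⟨NNReal.coe_lt_coe.2 (not_le.1 hcon), NNReal.coe_le_coe.2 hk⟩
          rw [if_pos hkT, if_neg (hnojump k hkT), add_zero]
          exact hUQ k hk0 hkT hkU.1
      · refine ⟨U, hUm, ?_, fun k hk0 hk hkU => ?_⟩
        · rw [if_neg fun h => hring h.2, add_zero]
          exact hUv
        · rcases le_or_gt k (n * h) with hkT | hkT
          · rw [if_pos hkT, if_neg (hnojump k hkT), add_zero]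
            exact hUQ k hk0 hkT hkU
          · have hlt : M.lam * M.f (a (X (n * h) w.1)) * elapsed (n * h) h k < w.2 :=
              (mul_le_mul_of_nonneg_left (NNReal.coe_le_coe.2 (elapsed_le _ _ _)) hα).trans_lt
                (not_le.1 hring)
            rw [if_neg hkT.not_ge, if_neg (fun h => h.2.not_gt hlt), add_zero,
              if_pos ⟨hk, hlt.le⟩, hconst _ _ hkT.le]
            exact haQ _ (hle _) k hkT hk

variable {M}

/-- Lower bounds for the gap of near-optimal and of arbitrary production rates. -/
lemma SolvesHJB.exists_hjbGap_bounds {J : ℕ → ℝ → ℝ} {t : ℝ} (ht : 0 ≤ t)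
    (hJ : M.SolvesHJB (Icc 0 t) J) :
    ∃ B, 0 ≤ B ∧ (∀ y, ∀ s ∈ M.rates, ∀ u ∈ Icc 0 t, -B ≤ M.hjbGap J y s u) ∧
      ∀ u ∈ Icc 0 t, ∀ y ≤ M.ξ, ∃ a ∈ M.rates, (y = M.ξ → a = 0) ∧
        ∀ u' ∈ Icc 0 t, -(B * |u - u'|) ≤ M.hjbGap J y a u' := by
  obtain ⟨C, hC, hC'⟩ := hJ.exists_abs_toGo_le ht
  obtain ⟨R, hR⟩ := M.exists_abs_r_le
  have hC0 : 0 ≤ C := (abs_nonneg _).trans (hC 0 0)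
  have hR0 : 0 ≤ R := (abs_nonneg _).trans (hR 0 M.zero_mem_rates)
  have hK0 : (0 : ℝ) ≤ M.maxIntensity := NNReal.zero_le_coe
  have htoGo : ∀ y ≤ M.ξ, ∀ u ∈ Icc 0 t, M.toGo J ht y (t - u) = J y u := by
    intro y hy u hu
    rw [toGo, if_pos hy, sub_sub_cancel, projIcc_of_mem ht hu]
  have hbd : ∀ y ≤ M.ξ, ∀ u ∈ Icc 0 t, |J y u| ≤ C := fun y hy u hu =>
    htoGo y hy u hu ▸ hC _ _
  have hlip' : ∀ y ≤ M.ξ, ∀ u ∈ Icc 0 t, ∀ u' ∈ Icc 0 t, u ≤ u' →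
      |J y u - J y u'| ≤ C * |u - u'| := by
    intro y hy u hu u' hu' huu
    rw [← htoGo y hy u hu, ← htoGo y hy u' hu', hJ.toGo_sub_toGo ht y (by linarith [hu'.2])
      (by linarith) (by linarith [hu.1])]
    have := intervalIntegral.norm_integral_le_of_norm_le_const (a := t - u') (b := t - u)
      (f := M.toGoDeriv J ht y) (fun k _ => hC' y k)
    rwa [sub_sub_sub_cancel_left, abs_sub_comm] at this
  have hlip : ∀ y ≤ M.ξ, ∀ u ∈ Icc 0 t, ∀ u' ∈ Icc 0 t, |J y u - J y u'| ≤ C * |u - u'| := by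
    intro y hy u hu u' hu'
    rcases le_total u u' with huu | huu
    · exact hlip' y hy u hu u' hu' huu
    · rw [abs_sub_comm, abs_sub_comm u]
      exact hlip' y hy u' hu' u hu huu
  have hB0 : 0 ≤ R + 2 * C * M.maxIntensity + (|M.hamiltonian 0| + 2 * C * M.maxIntensity) := by
    have := abs_nonneg (M.hamiltonian 0)
    positivity
  -- The first entry bounds the size of the gap, the price of a jump being at most `2 * C`. The
  -- second bounds its deterioration in time: the price is `2 * C`-Lipschitz and enters both the net
  -- revenue and the Hamiltonian with factor at most `maxIntensity`.
  refine ⟨max (R + 2 * C * M.maxIntensity + (|M.hamiltonian 0| + 2 * C * M.maxIntensity))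
    (4 * C * M.maxIntensity), hB0.trans (le_max_left _ _), ?_, ?_⟩
  · intro y s hs u hu
    refine (neg_le_neg (le_max_left _ _)).trans ?_
    unfold hjbGap
    split_ifs with hy
    · have hΔ : |J y u - J (y + 1) u| ≤ 2 * C :=
        abs_sub_le_two_mul (hbd _ hy.le _ hu) (hbd _ hy _ hu)
      have h1 : |M.lam * M.f s * (J y u - J (y + 1) u)| ≤ M.maxIntensity * (2 * C) := by
        rw [abs_mul, abs_of_nonneg (M.intensity_nonneg hs)]
        exact mul_le_mul (M.intensity_le hs) hΔ (abs_nonneg _) hK0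
      have h2 := M.hamiltonian_le_add (J y u - J (y + 1) u) 0
      rw [sub_zero] at h2
      have h3 := mul_le_mul_of_nonneg_left hΔ hK0
      have h4 := (abs_le.1 (hR s hs)).1
      have h5 := (abs_le.1 h1).2
      have h6 := le_abs_self (M.hamiltonian 0)
      linarith
    · linarith
  · intro u hu y hy
    rcases hy.eq_or_lt with rfl | hlt
    · refine ⟨0, M.zero_mem_rates, fun _ => rfl, fun u' _ => ?_⟩
      rw [hjbGap, if_neg (lt_irrefl _), neg_nonpos]
      exact mul_nonneg (hB0.trans (le_max_left _ _)) (abs_nonneg _)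
    · obtain ⟨a, ha, hmax⟩ := M.exists_hamiltonian_eq (J y u - J (y + 1) u)
      refine ⟨a, ha, fun h => absurd h hlt.ne, fun u' hu' => ?_⟩
      refine (neg_le_neg (mul_le_mul_of_nonneg_right (le_max_right _ _) (abs_nonneg _))).trans ?_
      rw [hjbGap, if_pos hlt]
      have hΔ : |(J y u' - J (y + 1) u') - (J y u - J (y + 1) u)| ≤ 2 * (C * |u - u'|) := by
        have e : (J y u' - J (y + 1) u') - (J y u - J (y + 1) u)
            = (J (y + 1) u - J (y + 1) u') - (J y u - J y u') := by ring
        rw [e]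
        exact abs_sub_le_two_mul (hlip _ hlt _ hu _ hu') (hlip _ hlt.le _ hu _ hu')
      have h1 := M.hamiltonian_le_add (J y u' - J (y + 1) u') (J y u - J (y + 1) u)
      have h2 : M.lam * M.f a * ((J y u' - J (y + 1) u') - (J y u - J (y + 1) u))
          ≤ M.maxIntensity * |(J y u' - J (y + 1) u') - (J y u - J (y + 1) u)| :=
        (mul_le_mul_of_nonneg_left (le_abs_self _) (M.intensity_nonneg ha)).trans
          (mul_le_mul_of_nonneg_right (M.intensity_le ha) (abs_nonneg _))
      have h3 := mul_le_mul_of_nonneg_left hΔ hK0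
      linarith

/-- A path integral is nearly non-negative if the integrand is, except on a small set. -/
lemma neg_le_intervalIntegral_of_forall_notMem {g : ℝ → ℝ} {t ε B m : ℝ} (ht : 0 ≤ t)
    (hε : 0 ≤ ε) (hB : 0 ≤ B) (hm : 0 ≤ m) {U : Set ℝ} (hU : MeasurableSet U)
    (hUm : volume U ≤ ENNReal.ofReal m) (hgB : ∀ k ∈ Ioc 0 t, -B ≤ g k)
    (hgε : ∀ k ∈ Ioc 0 t, k ∉ U → -ε ≤ g k) : -(ε * t + B * m) ≤ ∫ k in (0 : ℝ)..t, g k := by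
  by_cases hg : IntervalIntegrable g volume 0 t
  · rw [intervalIntegral.integral_of_le ht]
    have hc : ∀ c : ℝ, IntegrableOn (fun _ : ℝ => c) (Ioc 0 t) := fun c =>
      integrableOn_const (by simp)
    have hi : IntegrableOn (fun k => -ε + U.indicator (fun _ => -B) k) (Ioc 0 t) :=
      (hc _).add ((hc _).indicator hU)
    have hmono := setIntegral_mono_on hi ((intervalIntegrable_iff_integrableOn_Ioc_of_le ht).1 hg)
      measurableSet_Ioc fun k hk => by
        by_cases hkU : k ∈ U
        · rw [indicator_of_mem hkU]; linarith [hgB k hk]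
        · rw [indicator_of_notMem hkU, add_zero]; exact hgε k hk hkU
    refine le_trans ?_ hmono
    rw [integral_add (hc _) ((hc _).indicator hU), setIntegral_indicator hU, setIntegral_const,
      setIntegral_const, Real.volume_real_Ioc_of_le ht]
    have hvol : volume.real (Ioc 0 t ∩ U) ≤ m :=
      ENNReal.toReal_le_of_le_ofReal hm ((measure_mono inter_subset_right).trans hUm)
    have := mul_le_mul_of_nonneg_left hvol hB
    simp only [smul_eq_mul]
    linarith
  -- A non-integrable function has integral `0` by convention.
  · rw [intervalIntegral.integral_undef hg, neg_nonpos]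
    positivity

/-- Some policy attains a solution of the HJB system up to an arbitrarily small error. -/
theorem SolvesHJB.exists_mem_attainableProfits {J : ℕ → ℝ → ℝ} {t : ℝ} (ht : 0 ≤ t)
    (hJ : M.SolvesHJB (Icc 0 t) J) {x : ℕ} (hx : x ≤ M.ξ) {η : ℝ} (hη : 0 < η) :
    ∃ v ∈ M.attainableProfits x t, J x t - η ≤ v := by
  obtain ⟨B, hB, hgB, hsel⟩ := hJ.exists_hjbGap_bounds ht
  -- With `h = t / (n + 1)`, stale rates lose at most `B * h * t` and the written-off intervals at
  -- most `B * (ξ * h)`, together `S / (n + 1)`.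
  set S : ℝ := B * t * t + B * (M.ξ * t) with hS
  have hS0 : 0 ≤ S := by positivity
  obtain ⟨n, hn⟩ := exists_nat_gt (S / η)
  set h : ℝ≥0 := (t / (n + 1)).toNNReal with hh
  have hhr : (h : ℝ) = t / (n + 1) := Real.coe_toNNReal _ (by positivity)
  have hnh : (((n + 1 : ℕ) : ℝ≥0) * h : ℝ) = t := by
    rw [hhr]; push_cast; field_simp
  have hgrid : ∀ i < n + 1, ((i : ℝ) + 1) * h ≤ t := by
    intro i hi
    rw [← hnh]
    refine mul_le_mul_of_nonneg_right ?_ h.coe_nonneg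
    exact_mod_cast Nat.succ_le_of_lt hi
  obtain ⟨Ω, mΩ, P, hP, ℱ, X, s, hadm, -, -, hU⟩ := M.exists_isAdmissible_forall_notMem
    (Q := fun k y a => -(B * h) ≤ M.hjbGap J y a (t - k)) hx h (n + 1) (by
      intro i hi y hy
      have hit := hgrid i hi
      have hi0 : (0 : ℝ) ≤ i * h := by positivity
      obtain ⟨a, ha, ha0, hgap⟩ := hsel (t - i * h) ⟨by linarith [h.coe_nonneg], by linarith⟩ y hy
      refine ⟨a, ha, ha0, fun k hk hk' => ?_⟩
      have h1 : (i : ℝ) * h < k := by exact_mod_cast hk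
      have h2 : (k : ℝ) ≤ (i + 1) * h := by exact_mod_cast hk'
      refine le_trans (neg_le_neg (mul_le_mul_of_nonneg_left ?_ hB))
        (hgap (t - k) ⟨by linarith, by linarith⟩)
      rw [sub_sub_sub_cancel_left, abs_of_nonneg (by linarith)]
      linarith)
  refine ⟨_, ⟨Ω, mΩ, P, hP, ℱ, X, s, hadm, rfl⟩, hadm.le_expectedProfit ht hJ ?_⟩
  filter_upwards [hU, hadm.level_le] with ω hω hle
  obtain ⟨U, hUm, hUv, hUQ⟩ := hω
  have hvol : volume U ≤ ENNReal.ofReal (M.ξ * h) := by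
    refine hUv.trans ?_
    rw [ENNReal.ofReal_mul (Nat.cast_nonneg _), ENNReal.ofReal_natCast, ENNReal.ofReal_coe_nnreal]
    exact mul_le_mul_left (by exact_mod_cast hle _) _
  refine le_trans ?_ (neg_le_intervalIntegral_of_forall_notMem ht (ε := B * h) (B := B)
    (m := M.ξ * h) (by positivity) hB (by positivity) hUm hvol (fun k hk => ?_)
    fun k hk hkU => ?_)
  · rw [neg_le_neg_iff, hhr]
    have e : B * (t / (n + 1)) * t + B * (M.ξ * (t / (n + 1))) = S / (n + 1) := by
      rw [hS]; ring
    rw [e, div_le_iff₀ (by positivity)]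
    rw [div_lt_iff₀ hη] at hn
    linarith
  · exact hgB _ _ (hadm.rate_mem _ _) _ ⟨by linarith [hk.2], by linarith [hk.1]⟩
  · have hk' : ((k.toNNReal : ℝ≥0) : ℝ) = k := Real.coe_toNNReal _ hk.1.le
    have := hUQ k.toNNReal (Real.toNNReal_pos.2 hk.1) (by
      rw [← NNReal.coe_le_coe, hk', NNReal.coe_mul, hnh]; exact hk.2) (by rwa [hk'])
    rwa [hk'] at this

/-! ### Identification of the optimal profit -/

theorem SolvesHJB.isLUB_attainableProfits {J : ℕ → ℝ → ℝ} {t : ℝ} (ht : 0 ≤ t)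
    (hJ : M.SolvesHJB (Icc 0 t) J) {x : ℕ} (hx : x ≤ M.ξ) :
    IsLUB (M.attainableProfits x t) (J x t) := by
  refine ⟨?_, fun b hb => le_of_forall_pos_le_add fun η hη => ?_⟩
  · rintro _ ⟨Ω, mΩ, P, hP, ℱ, X, s, hadm, rfl⟩
    exact hadm.expectedProfit_le ht hJ
  · obtain ⟨v, hv, hle⟩ := hJ.exists_mem_attainableProfits ht hx hη
    linarith [hb hv]

/-- Uniqueness comes from here: the right-hand side is an arbitrary solution, the left-hand side
does not depend on it. -/
theorem SolvesHJB.optimalProfit_eq {J : ℕ → ℝ → ℝ} {T : ℝ} (hJ : M.SolvesHJB (Icc 0 T) J)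
    {x : ℕ} (hx : x ≤ M.ξ) {t : ℝ} (ht : t ∈ Icc 0 T) : M.optimalProfit x t = J x t := by
  have hJ' := hJ.mono (Icc_subset_Icc_right ht.2)
  obtain ⟨v, hv, -⟩ := hJ'.exists_mem_attainableProfits ht.1 hx one_pos
  exact (hJ'.isLUB_attainableProfits ht.1 hx).csSup_eq ⟨v, hv⟩

variable (M) in
-- Being a solution is local in time. The horizon `t + 1` makes `[0, t + 1]` a neighbourhood of `t`
-- within the half-line, so derivatives carry over from a solution on that horizon.
theorem solvesHJB_optimalProfit : M.SolvesHJB (Ici 0) M.optimalProfit := by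
  have hmem : ∀ t : ℝ, 0 ≤ t → t ∈ Icc 0 (t + 1) := fun t ht => ⟨ht, by linarith⟩
  have hnhds : ∀ t : ℝ, Icc 0 (t + 1) ∈ nhdsWithin t (Ici 0) := fun t => by
    rw [← Ici_inter_Iic]
    exact Filter.inter_mem self_mem_nhdsWithin
      (mem_nhdsWithin_of_mem_nhds (Iic_mem_nhds (by linarith)))
  refine ⟨fun x hx t ht => ?_, fun t ht => ?_, fun x hx => ?_⟩
  · obtain ⟨J, hJ⟩ := M.exists_solvesHJB (T := t + 1) (by linarith [mem_Ici.1 ht])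
    obtain ⟨d, hd, hd'⟩ := hJ.functioning x hx t (hmem t ht)
    refine ⟨d, ?_, ?_⟩
    · rwa [hJ.optimalProfit_eq hx.le (hmem t ht), hJ.optimalProfit_eq hx (hmem t ht)]
    · exact (hd'.congr (fun u hu => hJ.optimalProfit_eq hx.le hu)
        (hJ.optimalProfit_eq hx.le (hmem t ht))).mono_of_mem_nhdsWithin (hnhds t)
  · obtain ⟨J, hJ⟩ := M.exists_solvesHJB (T := t + 1) (by linarith [mem_Ici.1 ht])
    exact ((hJ.failed t (hmem t ht)).congr (fun u hu => hJ.optimalProfit_eq le_rfl hu)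
      (hJ.optimalProfit_eq le_rfl (hmem t ht))).mono_of_mem_nhdsWithin (hnhds t)
  · obtain ⟨J, hJ⟩ := M.exists_solvesHJB le_rfl
    rw [hJ.optimalProfit_eq hx ⟨le_rfl, le_rfl⟩, hJ.boundary x hx]

end ProductionModel

end

theorem lemma1 (M : ProductionModel) :
    -- `J*` is a genuine supremum: the attainable profits are non-empty and bounded above
    (∀ x ≤ M.ξ, ∀ t, 0 ≤ t → IsLUB (M.attainableProfits x t) (M.optimalProfit x t)) ∧
    -- `J*` solves the HJB system at all times to go
    M.SolvesHJB (Set.Ici 0) M.optimalProfit ∧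
    -- and it is the only solution on every planning horizon
    (∀ T, 0 < T → ∀ J : ℕ → ℝ → ℝ, M.SolvesHJB (Set.Icc 0 T) J →
      ∀ x ≤ M.ξ, ∀ t ∈ Set.Icc 0 T, J x t = M.optimalProfit x t) :=
  ⟨fun _ hx _ ht => (M.solvesHJB_optimalProfit.mono Icc_subset_Ici_self).isLUB_attainableProfits
      ht hx, M.solvesHJB_optimalProfit, fun _ _ _ hJ _ hx _ ht => (hJ.optimalProfit_eq hx ht).symm⟩
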